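/- **Setting.** Graphs are finite and undirected, with loops and multiple edges allowed. For $d:[n]\to\mathbb N$, take a set of half-edges in which each vertex $i\in[n]$ has exactly $d(i)$ half-edges. A complete matching is a set of $\lfloor \tfrac12\sum_i d(i)\rfloor$ pairwise disjoint pairs of distinct half-edges (so it covers all half-edges, except exactly one when $\sum_i d(i)$ is odd). Let $\mathbb G_d$ be the random multigraph on $[n]$ obtained from a uniformly random complete matching by putting, for each matched pair, an edge between the two vertices that carry its half-edges. For a graph $G$ let $$MB(G)=\max\{e(V_1,V_2) : V_1,V_2 \text{ partition } V(G),\ \big||V_1|-|V_2|\big|\le 1\},$$ where $e(V_1,V_2)$ is the number of edges of $G$ (with multiplicity) between $V_1$ and $V_2$. Let $\mu$ be a probability measure on $\mathbb N$ with finite mean $\overline\mu$. A sequence $d_n:[n]\to\mathbb N$ converges in distribution to $\mu$ if, as $n\to\infty$, $\frac1n\sum_{i\in[n]}\mathbf 1_{d_n(i)=k}\to\mu(k)$ for every $k\in\mathbb N$ and $\frac1n\sum_{i\in[n]}d_n(i)\to\overline\mu$. **Theorem 3.1.** Let $\{d_n\}_{n\ge1}$ converge in distribution to a probability measure $\mu$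 on $\mathbb N$ with finite mean. Then $\frac1n MB(\mathbb G_{d_n})$, where the $\mathbb G_{d_n}$ are sampled independently, converges almost surely to a deterministic limit as $n\to\infty$. Moreover, the scaling limit $\lim_{n\to\infty}\frac1n\mathbb E[MB(\mathbb G_{d_n})]$ exists, and it is equal to this almost sure limit. -/

import Mathlib

open MeasureTheory ProbabilityTheory Filter Topology

namespace ConfigurationModel

section Matchings

variable {n : ℕ}

/-- The half-edges of a degree function `d`: each vertex `i` occurs `d i` times. -/
abbrev HalfEdge (d : Fin n → ℕ) : Type := Σ i : Fin n, Fin (d i)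

/-- A (possibly partial) matching: a set of unordered pairs of distinct half-edges,
no two different pairs sharing a half-edge. -/
def IsMatching {d : Fin n → ℕ} (m : Finset (Sym2 (HalfEdge d))) : Prop :=
  (∀ e ∈ m, ¬ e.IsDiag) ∧ ∀ e ∈ m, ∀ f ∈ m, ∀ h : HalfEdge d, h ∈ e → h ∈ f → e = f

/-- A complete matching pairs up all the half-edges, except for exactly one of them
when the total degree `∑ i, d i` is odd; that is, it has `⌊(∑ i, d i) / 2⌋` pairs. -/
def CompleteMatching (d : Fin n → ℕ) : Type :=
  {m : Finset (Sym2 (HalfEdge d)) // IsMatching m ∧ m.card = (∑ i, d i) / 2}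

/-- The (finite) set of complete matchings carries the discrete σ-algebra. -/
instance (d : Fin n → ℕ) : MeasurableSpace (CompleteMatching d) := ⊤

/-- The uniform distribution on the complete matchings. -/
noncomputable def uniformMatching (d : Fin n → ℕ) : Measure (CompleteMatching d) :=
  uniformOn Set.univ

/-- The multigraph on `Fin n` induced by a matching: each matched pair of half-edges
is an edge (labelled by that pair) between the two vertices carrying the half-edges.
Loops and parallel edges may occur. -/
def inducedGraph {d : Fin n → ℕ} (m : Finset (Sym2 (HalfEdge d))) :
    Graph (Fin n) (Sym2 (HalfEdge d)) where
  vertexSet := Set.univ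
  IsLink e x y := e ∈ m ∧ e.map Sigma.fst = s(x, y)
  isLink_symm := fun _ _ => ⟨fun _ _ h => ⟨h.1, h.2.trans Sym2.eq_swap⟩⟩
  eq_or_eq_of_isLink_of_isLink := by
    rintro e x y v w ⟨_, h⟩ ⟨_, h'⟩
    have h2 := h.symm.trans h'
    rw [Sym2.eq_iff] at h2
    tauto
  left_mem_of_isLink := fun _ _ _ _ => Set.mem_univ _

end Matchings

section Bisection

variable {α β : Type*}

/-- `e(V₁, V₂)`: the number of edges, with multiplicity, between `V₁` and `V₂`. -/
noncomputable def edgesBetween (G : Graph α β) (V₁ V₂ : Set α) : ℕ :=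
  {e : β | ∃ x ∈ V₁, ∃ y ∈ V₂, G.IsLink e x y}.ncard

/-- `V₁, V₂` partition the vertex set and their sizes differ by at most one. -/
def IsBisection (G : Graph α β) (V₁ V₂ : Set α) : Prop :=
  V₁ ∪ V₂ = G.vertexSet ∧ Disjoint V₁ V₂ ∧ |(V₁.ncard : ℤ) - (V₂.ncard : ℤ)| ≤ 1

/-- The maximum bisection `MB(G)` of a finite multigraph; for finite `G` the supremum is over
a nonempty finite set of natural numbers, hence a maximum. -/
noncomputable def maxBisection (G : Graph α β) : ℕ :=
  sSup {k : ℕ | ∃ V₁ V₂ : Set α, IsBisection G V₁ V₂ ∧ k = edgesBetween G V₁ V₂}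

end Bisection

/-- The degree functions `d n : [n] → ℕ` converge in distribution to the law `μ` on `ℕ`
(of finite mean): the empirical frequencies and the empirical means converge. -/
def ConvergesInDistribution (d : (n : ℕ) → Fin n → ℕ) (μ : Measure ℕ) : Prop :=
  (∀ k : ℕ, Tendsto (fun n : ℕ => (1 / (n : ℝ)) * ∑ i : Fin n, if d n i = k then (1 : ℝ) else 0)
      atTop (𝓝 (μ.real {k}))) ∧
    Tendsto (fun n : ℕ => (1 / (n : ℝ)) * ∑ i : Fin n, (d n i : ℝ))
      atTop (𝓝 (∫ k, (k : ℝ) ∂μ))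

end ConfigurationModel

/-! A bisection is a balanced colouring of the vertices, hence a colouring of the half-edges, and
the maximum bisection is the largest number of matched pairs that it separates. Two facts suffice:
the mean divided by n converges, and the random value concentrates around its mean.

The mean is nearly superadditive under disjoint union of the vertex sets, by interpolation. For a
fixed pairing, call two points equivalent if every optimal colouring agrees on them; a new pair
raises the maximum by 1 exactly when its ends are inequivalent (`maxCut_insert`). If x and y are the
distributions of the equivalence classes among the free points on the two sides, then `∑ (x c - y c)
^ 2 ≥ 0` says that a random pair across the sides is, on average, at least as useful as a random
pair inside one side or the other, each with weight one half (`le_biMaxCut_bi`). Trading the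
crossing pairs one by one for inner pairs moves the number of free points on one side by a fair ±1
walk. `interpolation_bound` follows that walk with a quadratic potential, keeping 2D spare points on
each side so that sampling without replacement costs only 1/D per trade. With a suitable D the total
loss is at most η times the total degree of one part, plus a constant depending on η
(`exists_interpolation_error`).

The mean is also Lipschitz in the degrees for the ℓ¹ distance, up to a constant, and depends only on
the degree multiset. A long degree sequence is therefore compared with many copies of a shorter one,
padded by isolated vertices, through their tail counts (`mul_degMaxCut_le_of_tails`). Convergence of
the frequencies and of the means makes the tails close in ℓ¹ (`eventually_sum_abs_sub_le`), so the
limsup of the normalised means is at most their liminf (`exists_tendsto_degMaxCut`).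

For concentration, a uniform complete pairing is the image of a fixed one under a uniform
permutation, and a transposition changes the maximum by at most 2. A martingale argument gives a
sub-Gaussian exponential moment (`expect_exp_maxCut_le`), and Chernoff with Borel–Cantelli gives the
almost sure limit. -/

namespace ConfigurationModel

open Finset

set_option linter.unusedSectionVars false

/-! ### Partial pairings, cuts, and the effect of one new pair. -/

section Pairings

variable {H : Type*} [DecidableEq H]

/-- A finite set of pairwise disjoint unordered pairs of distinct elements. -/
def IsPairing (m : Finset (Sym2 H)) : Prop :=
  (∀ e ∈ m, ¬ e.IsDiag) ∧ ∀ e ∈ m, ∀ f ∈ m, ∀ h : H, h ∈ e → h ∈ f → e = f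

lemma isPairing_empty : IsPairing (∅ : Finset (Sym2 H)) := by simp [IsPairing]

lemma IsPairing.subset {m m' : Finset (Sym2 H)} (h : IsPairing m) (hs : m' ⊆ m) :
    IsPairing m' :=
  ⟨fun e he => h.1 e (hs he), fun e he f hf => h.2 e (hs he) f (hs hf)⟩

lemma IsPairing.ne {m : Finset (Sym2 H)} (hm : IsPairing m) {a b : H} (h : s(a, b) ∈ m) :
    a ≠ b := fun hab => hm.1 _ h (by simpa using hab)

/-- The number of pairs whose two elements get different colours. -/
def cut (τ : H → Bool) (m : Finset (Sym2 H)) : ℕ := #{e ∈ m | ¬ (e.map τ).IsDiag}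

/-- The maximum of `cut` over a set of colourings. -/
def maxCut (T : Finset (H → Bool)) (m : Finset (Sym2 H)) : ℕ := T.sup fun τ => cut τ m

lemma cut_insert (τ : H → Bool) {m : Finset (Sym2 H)} {a b : H} (h : s(a, b) ∉ m) :
    cut τ (insert s(a, b) m) = cut τ m + if τ a = τ b then 0 else 1 := by
  unfold cut
  rw [filter_insert]
  by_cases h1 : τ a = τ b
  · simp [h1]
  · rw [if_pos (by simpa using h1), if_neg h1, card_insert_of_notMem (by simp [h])]

lemma cut_not (τ : H → Bool) (m : Finset (Sym2 H)) : cut (fun h => !τ h) m = cut τ m := by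
  unfold cut
  congr 1
  apply filter_congr
  intro e _
  induction e with | _ a b => simp

lemma cut_le_card (τ : H → Bool) (m : Finset (Sym2 H)) : cut τ m ≤ #m := card_filter_le _ _

lemma maxCut_le_card (T : Finset (H → Bool)) (m : Finset (Sym2 H)) : maxCut T m ≤ #m :=
  Finset.sup_le fun τ _ => cut_le_card τ m

lemma cut_le_maxCut {T : Finset (H → Bool)} {τ : H → Bool} (hτ : τ ∈ T) (m : Finset (Sym2 H)) :
    cut τ m ≤ maxCut T m := Finset.le_sup (f := fun τ => cut τ m) hτ

lemma exists_cut_eq_maxCut {T : Finset (H → Bool)} (hT : T.Nonempty) (m : Finset (Sym2 H)) :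
    ∃ τ ∈ T, cut τ m = maxCut T m := by
  obtain ⟨τ, h, h'⟩ := exists_mem_eq_sup T hT (fun τ => cut τ m)
  exact ⟨τ, h, h'.symm⟩

/-- The colour class of `a`, described by the optimal colourings in which `a` is `true`. -/
def optClass (T : Finset (H → Bool)) (m : Finset (Sym2 H)) (a : H) : Finset (H → Bool) :=
  {τ ∈ T | cut τ m = maxCut T m ∧ τ a = true}

lemma optClass_eq_iff {T : Finset (H → Bool)} {m : Finset (Sym2 H)} {a b : H} :
    optClass T m a = optClass T m b ↔ ∀ τ ∈ T, cut τ m = maxCut T m → τ a = τ b := by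
  unfold optClass
  constructor
  · intro h τ hτ hc
    have := congrArg (τ ∈ ·) h
    simp only [mem_filter, hτ, hc, true_and, eq_iff_iff] at this
    exact Bool.eq_iff_iff.2 this
  · intro h
    apply filter_congr
    intro τ hτ
    constructor <;> rintro ⟨h1, h2⟩ <;> have := h τ hτ h1 <;> simp_all

variable [Fintype H]

/-- An optimal colouring gains at most 1 from the new pair and a non-optimal one starts at least 1
lower, so only the optimal ones decide. The increment becomes a function of a partition of the
points, which is what the convexity argument needs. -/
lemma maxCut_insert {T : Finset (H → Bool)} (hT : T.Nonempty) {m : Finset (Sym2 H)} {a b : H}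
    (h : s(a, b) ∉ m) :
    maxCut T (insert s(a, b) m) =
      maxCut T m + if optClass T m a = optClass T m b then 0 else 1 := by
  apply le_antisymm
  · apply Finset.sup_le
    intro τ hτ
    rw [cut_insert τ h]
    have h1 := cut_le_maxCut hτ m
    split_ifs with h2 h3 h3
    · omega
    · omega
    · rw [optClass_eq_iff] at h3
      have := h3 τ hτ
      have : cut τ m ≠ maxCut T m := fun h => h2 (this h)
      omega
    · omega
  · split_ifs with h3
    · obtain ⟨τ, hτ, h1⟩ := exists_cut_eq_maxCut hT m
      have := cut_le_maxCut hτ (insert s(a, b) m)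
      rw [cut_insert τ h] at this
      omega
    · rw [optClass_eq_iff] at h3
      push Not at h3
      obtain ⟨τ, hτ, h1, h2⟩ := h3
      have := cut_le_maxCut hτ (insert s(a, b) m)
      rw [cut_insert τ h, if_neg h2] at this
      omega

/-- The elements that are not covered by a pairing. -/
def free (m : Finset (Sym2 H)) : Finset H := {h | ∀ e ∈ m, h ∉ e}

lemma mem_free {m : Finset (Sym2 H)} {h : H} : h ∈ free m ↔ ∀ e ∈ m, h ∉ e := by simp [free]

lemma notMem_of_mem_free {m : Finset (Sym2 H)} {a b : H} (ha : a ∈ free m) : s(a, b) ∉ m :=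
  fun h => mem_free.1 ha _ h (by simp)

lemma free_insert (m : Finset (Sym2 H)) (a b : H) :
    free (insert s(a, b) m) = (free m \ {a, b}) := by
  ext h
  simp only [mem_free, mem_insert, forall_eq_or_imp, Sym2.mem_iff, Finset.mem_sdiff, mem_singleton]
  tauto

lemma IsPairing.insert {m : Finset (Sym2 H)} (hm : IsPairing m) {a b : H} (ha : a ∈ free m)
    (hb : b ∈ free m) (hab : a ≠ b) : IsPairing (insert s(a, b) m) := by
  constructor
  · intro e he
    rcases mem_insert.1 he with rfl | he
    · simpa using hab
    · exact hm.1 e he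
  · rw [mem_free] at ha hb
    intro e he f hf h h1 h2
    rcases mem_insert.1 he with rfl | he' <;> rcases mem_insert.1 hf with rfl | hf'
    · rfl
    · rcases Sym2.mem_iff.1 h1 with rfl | rfl
      · exact absurd h2 (ha f hf')
      · exact absurd h2 (hb f hf')
    · rcases Sym2.mem_iff.1 h2 with rfl | rfl
      · exact absurd h1 (ha e he')
      · exact absurd h1 (hb e he')
    · exact hm.2 e he' f hf' h h1 h2

lemma IsPairing.mem_free_erase {m : Finset (Sym2 H)} (hm : IsPairing m) {a b : H}
    (h : s(a, b) ∈ m) : a ∈ free (m.erase s(a, b)) ∧ b ∈ free (m.erase s(a, b)) := by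
  simp only [mem_free, mem_erase]
  exact ⟨fun e he h' => he.1 (hm.2 e he.2 _ h a h' (by simp)),
    fun e he h' => he.1 (hm.2 e he.2 _ h b h' (by simp))⟩

lemma IsPairing.card_free {m : Finset (Sym2 H)} (hm : IsPairing m) :
    #(free m) + 2 * #m = Fintype.card H := by
  induction m using Finset.induction_on with
  | empty => simp [free]
  | insert e m he ih =>
    have h1 := ih (hm.subset (subset_insert _ _))
    induction e with | _ a b =>
    have h2 := hm.mem_free_erase (mem_insert_self _ _)
    rw [erase_insert he] at h2
    have h3 : a ≠ b := hm.ne (mem_insert_self _ _)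
    rw [free_insert, card_sdiff_of_subset (by simp [insert_subset_iff, h2]), card_pair h3,
      card_insert_of_notMem he]
    have : #({a, b} : Finset H) ≤ #(free m) := card_le_card (by simp [insert_subset_iff, h2])
    rw [card_pair h3] at this
    omega

/-- Each point of colour `c` is free, or in a monochromatic pair, or in a bichromatic one. The
middle term counts ordered pairs, so each monochromatic pair contributes its two points. -/
lemma IsPairing.card_free_filter {m : Finset (Sym2 H)} (hm : IsPairing m) (p : H → Bool)
    (c : Bool) :
    #{h ∈ free m | p h = c} + #{q : H × H | s(q.1, q.2) ∈ m ∧ p q.1 = c ∧ p q.2 = c}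
      + cut p m = #{h : H | p h = c} := by
  induction m using Finset.induction_on with
  | empty => simp [free, cut]
  | insert e m he ih =>
    have h1 := ih (hm.subset (subset_insert _ _))
    induction e with | _ a b =>
    have h2 := hm.mem_free_erase (mem_insert_self _ _)
    rw [erase_insert he] at h2
    have h3 : a ≠ b := hm.ne (mem_insert_self _ _)
    rw [cut_insert p he]
    have e1 : #{h ∈ free m | p h = c} = #{h ∈ free (Insert.insert s(a, b) m) | p h = c} +
        #{h ∈ ({a, b} : Finset H) | p h = c} := by
      rw [← card_union_of_disjoint]
      · congr 1
        ext h
        rw [free_insert]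
        simp only [mem_union, mem_filter, Finset.mem_sdiff, mem_insert, mem_singleton]
        constructor
        · tauto
        · rintro (h | ⟨rfl | rfl, h⟩) <;> tauto
      · rw [Finset.disjoint_left]
        intro h
        rw [free_insert]
        simp only [mem_filter, Finset.mem_sdiff]
        tauto
    have e2 : #{q : H × H | s(q.1, q.2) ∈ Insert.insert s(a, b) m ∧ p q.1 = c ∧ p q.2 = c} =
        #{q : H × H | s(q.1, q.2) ∈ m ∧ p q.1 = c ∧ p q.2 = c} +
        #{q ∈ ({(a, b), (b, a)} : Finset (H × H)) | p q.1 = c ∧ p q.2 = c} := by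
      rw [← card_union_of_disjoint]
      · congr 1
        ext ⟨x, y⟩
        simp only [mem_union, mem_filter, mem_insert, mem_singleton, mem_univ, true_and,
          Sym2.eq_iff, Prod.mk.injEq]
        tauto
      · rw [Finset.disjoint_left]
        rintro ⟨x, y⟩
        simp only [mem_filter, mem_insert, mem_singleton, mem_univ, true_and, Prod.mk.injEq]
        rintro h ⟨⟨rfl, rfl⟩ | ⟨rfl, rfl⟩, -⟩
        · exact he h.1
        · exact he (by rw [Sym2.eq_swap]; exact h.1)
    have h4 : (a, b) ≠ (b, a) := by simp [h3]
    rw [e2]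
    rw [e1] at h1
    have e3 : #{h ∈ ({a, b} : Finset H) | p h = c} =
        (if p a = c then 1 else 0) + if p b = c then 1 else 0 := by
      rw [card_filter, sum_pair h3]
    have e4 : #{q ∈ ({(a, b), (b, a)} : Finset (H × H)) | p q.1 = c ∧ p q.2 = c} =
        (if p a = c ∧ p b = c then 1 else 0) + if p b = c ∧ p a = c then 1 else 0 := by
      rw [card_filter, sum_pair h4]
    rw [e3] at h1
    rw [e4]
    revert h1
    rcases p a <;> rcases p b <;> rcases c <;> simp <;> omega

lemma card_filter_eq_cut (m : Finset (Sym2 H)) (p : H → Bool) :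
    #{q : H × H | s(q.1, q.2) ∈ m ∧ p q.1 = true ∧ p q.2 = false} = cut p m := by
  unfold cut
  apply card_bij (fun q _ => s(q.1, q.2))
  · rintro ⟨a, b⟩ h
    simp only [mem_filter, mem_univ, true_and] at h
    simp [h]
  · rintro ⟨a, b⟩ h ⟨a', b'⟩ h'
    simp only [mem_filter, mem_univ, true_and] at h h'
    rw [Sym2.eq_iff]
    rintro (⟨rfl, rfl⟩ | ⟨rfl, rfl⟩)
    · rfl
    · simp_all
  · intro e he
    simp only [mem_filter] at he
    induction e with | _ a b =>
    have h2 : p a ≠ p b := by simpa using he.2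
    rcases ha : p a
    · exact ⟨(b, a), by simp_all [Sym2.eq_swap], Sym2.eq_swap⟩
    · exact ⟨(a, b), by simp_all, rfl⟩

end Pairings

/-! ### Uniform pairings with prescribed colour statistics, built one pair at a time. -/

section Interpolation

variable {H : Type*} [DecidableEq H] [Fintype H]

lemma sum_sum_insert {S S' : Finset (Finset (Sym2 H))} {P : Finset (H × H)}
    (h1 : ∀ m ∈ S, ∀ q ∈ P, q.1 ∈ free m → q.2 ∈ free m → insert s(q.1, q.2) m ∈ S')
    (h2 : ∀ m ∈ S', ∀ q ∈ P, s(q.1, q.2) ∈ m →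
      m.erase s(q.1, q.2) ∈ S ∧ q.1 ∈ free (m.erase s(q.1, q.2)) ∧
        q.2 ∈ free (m.erase s(q.1, q.2)))
    (φ : Finset (Sym2 H) → ℝ) :
    ∑ m ∈ S, ∑ q ∈ P with q.1 ∈ free m ∧ q.2 ∈ free m, φ (insert s(q.1, q.2) m) =
      ∑ m ∈ S', ∑ q ∈ P with s(q.1, q.2) ∈ m, φ m := by
  rw [sum_sigma', sum_sigma']
  refine sum_bij' (fun x _ => ⟨insert s(x.2.1, x.2.2) x.1, x.2⟩)
    (fun x _ => ⟨x.1.erase s(x.2.1, x.2.2), x.2⟩) ?_ ?_ ?_ ?_ ?_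
  · rintro ⟨m, q⟩ h
    simp only [mem_sigma, mem_filter] at h ⊢
    exact ⟨h1 m h.1 q h.2.1 h.2.2.1 h.2.2.2, h.2.1, by simp⟩
  · rintro ⟨m, q⟩ h
    simp only [mem_sigma, mem_filter] at h ⊢
    have := h2 m h.1 q h.2.1 h.2.2
    exact ⟨this.1, h.2.1, this.2⟩
  · rintro ⟨m, q⟩ h
    simp only [mem_sigma, mem_filter] at h
    simp only
    rw [erase_insert (notMem_of_mem_free h.2.2.1)]
  · rintro ⟨m, q⟩ h
    simp only [mem_sigma, mem_filter] at h
    simp only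
    rw [insert_erase h.2.2]
  · rintro ⟨m, q⟩ h
    rfl

/-- Double counting of (pairing, marked pair): every pairing in `S` has `c` extensions and every
pairing in `S'` has `c'` removals, so a uniform element of `S` extended by a uniform admissible pair
is uniform on `S'`. Nonemptiness is carried along because `Finset.expect` over the empty set is 0.
-/
lemma expect_insert {S S' : Finset (Finset (Sym2 H))} {P : Finset (H × H)} {c c' : ℕ}
    (hc : 0 < c) (hS : S.Nonempty)
    (h1 : ∀ m ∈ S, ∀ q ∈ P, q.1 ∈ free m → q.2 ∈ free m → insert s(q.1, q.2) m ∈ S')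
    (h2 : ∀ m ∈ S', ∀ q ∈ P, s(q.1, q.2) ∈ m →
      m.erase s(q.1, q.2) ∈ S ∧ q.1 ∈ free (m.erase s(q.1, q.2)) ∧
        q.2 ∈ free (m.erase s(q.1, q.2)))
    (h3 : ∀ m ∈ S, #{q ∈ P | q.1 ∈ free m ∧ q.2 ∈ free m} = c)
    (h4 : ∀ m ∈ S', #{q ∈ P | s(q.1, q.2) ∈ m} = c') :
    S'.Nonempty ∧ ∀ φ : Finset (Sym2 H) → ℝ, S'.expect φ =
      S.expect fun m => Finset.expect {q ∈ P | q.1 ∈ free m ∧ q.2 ∈ free m}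
        fun q => φ (insert s(q.1, q.2) m) := by
  have hS' : S'.Nonempty := by
    obtain ⟨m, hm⟩ := hS
    have h5 := h3 m hm
    obtain ⟨q, hq⟩ := card_pos.1 (h5 ▸ hc)
    simp only [mem_filter] at hq
    exact ⟨_, h1 m hm q hq.1 hq.2.1 hq.2.2⟩
  refine ⟨hS', fun φ => ?_⟩
  have key : ∀ φ : Finset (Sym2 H) → ℝ,
      ∑ m ∈ S, (c : ℝ) * Finset.expect {q ∈ P | q.1 ∈ free m ∧ q.2 ∈ free m}
        (fun q => φ (insert s(q.1, q.2) m)) = ∑ m ∈ S', (c' : ℝ) * φ m := by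
    intro φ
    have := sum_sum_insert h1 h2 φ
    rw [sum_congr rfl fun m hm => ?_, this, sum_congr rfl fun m hm => ?_]
    · rw [sum_const, h4 m hm, nsmul_eq_mul]
    · rw [← card_mul_expect, h3 m hm]
  have k1 := key (fun _ => 1)
  have e1 : ∑ m ∈ S, (c : ℝ) * Finset.expect {q ∈ P | q.1 ∈ free m ∧ q.2 ∈ free m}
        (fun _ => (1 : ℝ)) = #S * c := by
    rw [sum_congr rfl fun m hm => by
      rw [expect_const (card_pos.1 (by rw [h3 m hm]; exact hc))], sum_const, nsmul_eq_mul, mul_one]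
  rw [e1, sum_const, nsmul_eq_mul, mul_one] at k1
  have k2 := key φ
  rw [← mul_sum, ← mul_sum] at k2
  rw [expect_eq_sum_div_card, expect_eq_sum_div_card]
  have p1 : (0 : ℝ) < #S := by exact_mod_cast card_pos.2 hS
  have p2 : (0 : ℝ) < #S' := by exact_mod_cast card_pos.2 hS'
  have p3 : (0 : ℝ) < c := by exact_mod_cast hc
  rw [div_eq_div_iff p2.ne' p1.ne']
  have : (c : ℝ) * ((∑ i ∈ S', φ i) * #S) = c * ((∑ m ∈ S, Finset.expect
      {q ∈ P | q.1 ∈ free m ∧ q.2 ∈ free m} (fun q => φ (insert s(q.1, q.2) m))) * #S') := by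
    linear_combination (∑ i ∈ S', φ i) * k1 - (#S' : ℝ) * k2
  exact mul_left_cancel₀ p3.ne' this

open scoped Classical in
/-- The pairings leaving `f` (resp. `g`) elements of colour `true` (resp. `false`) uncovered and
having `r` bichromatic pairs. -/
noncomputable def bipairings (p : H → Bool) (f g r : ℕ) : Finset (Finset (Sym2 H)) :=
  {m | IsPairing m ∧ #{h ∈ free m | p h = true} = f ∧ #{h ∈ free m | p h = false} = g ∧
    cut p m = r}

lemma mem_bipairings {p : H → Bool} {f g r : ℕ} {m : Finset (Sym2 H)} :
    m ∈ bipairings p f g r ↔ IsPairing m ∧ #{h ∈ free m | p h = true} = f ∧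
      #{h ∈ free m | p h = false} = g ∧ cut p m = r := by simp [bipairings]

lemma bipairings_not (p : H → Bool) (f g r : ℕ) :
    bipairings (fun h => !p h) f g r = bipairings p g f r := by
  ext m
  simp only [mem_bipairings, cut_not, Bool.not_eq_true', Bool.not_eq_false']
  tauto

lemma card_free_filter_insert {m : Finset (Sym2 H)} {a b : H} (ha : a ∈ free m) (hb : b ∈ free m)
    (hab : a ≠ b) (p : H → Bool) (c : Bool) :
    #{h ∈ free (insert s(a, b) m) | p h = c} + (if p a = c then 1 else 0) +
      (if p b = c then 1 else 0) = #{h ∈ free m | p h = c} := by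
  have e3 : #{h ∈ ({a, b} : Finset H) | p h = c} =
      (if p a = c then 1 else 0) + if p b = c then 1 else 0 := by
    rw [card_filter, sum_pair hab]
  rw [add_assoc, ← e3, ← card_union_of_disjoint]
  · congr 1
    ext h
    rw [free_insert]
    simp only [mem_union, mem_filter, Finset.mem_sdiff, mem_insert, mem_singleton]
    constructor
    · rintro (h | ⟨rfl | rfl, h⟩) <;> tauto
    · tauto
  · rw [Finset.disjoint_left]
    intro h
    rw [free_insert]
    simp only [mem_filter, Finset.mem_sdiff]
    tauto

lemma mem_free_filter_mono {m : Finset (Sym2 H)} (hm : IsPairing m) {a b : H}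
    (h : s(a, b) ∈ m) (p : H → Bool) (c : Bool) :
    #{h ∈ free (m.erase s(a, b)) | p h = c} =
    #{h ∈ free m | p h = c} + (if p a = c then 1 else 0) + (if p b = c then 1 else 0) := by
  have h2 := hm.mem_free_erase h
  rw [← card_free_filter_insert h2.1 h2.2 (hm.ne h), insert_erase h]

lemma cut_erase {m : Finset (Sym2 H)} {a b : H}
    (h : s(a, b) ∈ m) (p : H → Bool) :
    cut p m = cut p (m.erase s(a, b)) + if p a = p b then 0 else 1 := by
  have := cut_insert p (m := m.erase s(a, b)) (a := a) (b := b) (by simp)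
  rwa [insert_erase h] at this

lemma expect_insert_mono (p : H → Bool) (f g r : ℕ) (hS : (bipairings p (f + 2) g r).Nonempty) :
    (bipairings p f g r).Nonempty ∧ ∀ φ : Finset (Sym2 H) → ℝ, (bipairings p f g r).expect φ =
      (bipairings p (f + 2) g r).expect fun m =>
        (Finset.offDiag {h ∈ free m | p h = true}).expect
          fun q => φ (insert s(q.1, q.2) m) := by
  have hP : ∀ m : Finset (Sym2 H),
      ({q ∈ Finset.offDiag {h : H | p h = true} | q.1 ∈ free m ∧ q.2 ∈ free m} :
        Finset (H × H)) = Finset.offDiag {h ∈ free m | p h = true} := by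
    intro m
    ext q
    simp only [mem_filter, mem_offDiag, mem_univ, true_and]
    tauto
  have := expect_insert (S := bipairings p (f + 2) g r) (S' := bipairings p f g r)
    (P := Finset.offDiag {h : H | p h = true}) (c := (f + 2) * (f + 2) - (f + 2))
    -- The points of colour `true` covered by monochromatic pairs: one for each ordered pair to be
    -- removed.
    (c' := #{h : H | p h = true} - f - r) ?_ hS ?_ ?_ ?_ ?_
  · simpa only [hP] using this
  · have : (f + 2) * (f + 2) = (f + 2) * (f + 1) + (f + 2) := by ring
    rw [this, Nat.add_sub_cancel]
    positivity
  · rintro m hm ⟨a, b⟩ hq ha hb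
    simp only [mem_offDiag, mem_filter, mem_univ, true_and] at hq ha hb
    rw [mem_bipairings] at hm ⊢
    have e1 := card_free_filter_insert ha hb hq.2.2 p true
    have e2 := card_free_filter_insert ha hb hq.2.2 p false
    have e3 := cut_insert p (m := m) (notMem_of_mem_free ha (b := b))
    simp only [hq.1, hq.2.1, if_true] at e1 e2 e3
    refine ⟨hm.1.insert ha hb hq.2.2, ?_, ?_, ?_⟩ <;> simp at * <;> omega
  · rintro m hm ⟨a, b⟩ hq h
    simp only [mem_offDiag, mem_filter, mem_univ, true_and] at hq h
    rw [mem_bipairings] at hm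
    refine ⟨?_, hm.1.mem_free_erase h⟩
    rw [mem_bipairings]
    have e1 := mem_free_filter_mono hm.1 h p true
    have e2 := mem_free_filter_mono hm.1 h p false
    have e3 := cut_erase h p
    simp only [hq.1, hq.2.1, if_true] at e1 e2 e3
    refine ⟨hm.1.subset (erase_subset _ _), ?_, ?_, ?_⟩ <;> simp at * <;> omega
  · intro m hm
    rw [mem_bipairings] at hm
    rw [hP, offDiag_card, hm.2.1]
  · intro m hm
    rw [mem_bipairings] at hm
    have h := hm.1.card_free_filter p true
    rw [hm.2.1, hm.2.2.2] at h
    rw [← h]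
    have : (Finset.offDiag {h : H | p h = true}).filter (fun q => s(q.1, q.2) ∈ m) =
        Finset.univ.filter fun q : H × H => s(q.1, q.2) ∈ m ∧ p q.1 = true ∧ p q.2 = true := by
      ext ⟨a, b⟩
      simp only [mem_filter, mem_offDiag, mem_univ, true_and]
      constructor
      · tauto
      · exact fun h => ⟨⟨h.2.1, h.2.2, hm.1.ne h.1⟩, h.1⟩
    rw [this]
    omega

lemma expect_insert_bi (p : H → Bool) (f g r : ℕ)
    (hS : (bipairings p (f + 1) (g + 1) r).Nonempty) :
    (bipairings p f g (r + 1)).Nonempty ∧ ∀ φ : Finset (Sym2 H) → ℝ,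
      (bipairings p f g (r + 1)).expect φ =
      (bipairings p (f + 1) (g + 1) r).expect fun m =>
        (({h ∈ free m | p h = true} : Finset H) ×ˢ ({h ∈ free m | p h = false} : Finset H)).expect
          fun q => φ (insert s(q.1, q.2) m) := by
  have hP : ∀ m : Finset (Sym2 H),
      ({q ∈ (({h : H | p h = true} : Finset H) ×ˢ ({h : H | p h = false} : Finset H)) |
        q.1 ∈ free m ∧ q.2 ∈ free m} : Finset (H × H)) =
        ({h ∈ free m | p h = true} : Finset H) ×ˢ ({h ∈ free m | p h = false} : Finset H) := by
    intro m
    ext q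
    simp only [mem_filter, mem_product, mem_univ, true_and]
    tauto
  have := expect_insert (S := bipairings p (f + 1) (g + 1) r) (S' := bipairings p f g (r + 1))
    (P := ({h : H | p h = true} : Finset H) ×ˢ ({h : H | p h = false} : Finset H))
    (c := (f + 1) * (g + 1))
    (c' := r + 1) (by positivity) hS ?_ ?_ ?_ ?_
  · simpa only [hP] using this
  · rintro m hm ⟨a, b⟩ hq ha hb
    simp only [mem_product, mem_filter, mem_univ, true_and] at hq ha hb
    rw [mem_bipairings] at hm ⊢
    have hab : a ≠ b := by rintro rfl; simp_all
    have e1 := card_free_filter_insert ha hb hab p true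
    have e2 := card_free_filter_insert ha hb hab p false
    have e3 := cut_insert p (m := m) (notMem_of_mem_free ha (b := b))
    simp only [hq.1, hq.2, if_true] at e1 e2 e3
    refine ⟨hm.1.insert ha hb hab, ?_, ?_, ?_⟩ <;> simp at * <;> omega
  · rintro m hm ⟨a, b⟩ hq h
    simp only [mem_product, mem_filter, mem_univ, true_and] at hq h
    rw [mem_bipairings] at hm
    refine ⟨?_, hm.1.mem_free_erase h⟩
    rw [mem_bipairings]
    have e1 := mem_free_filter_mono hm.1 h p true
    have e2 := mem_free_filter_mono hm.1 h p false
    have e3 := cut_erase h p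
    simp only [hq.1, hq.2, if_true] at e1 e2 e3
    refine ⟨hm.1.subset (erase_subset _ _), ?_, ?_, ?_⟩ <;> simp at * <;> omega
  · intro m hm
    rw [mem_bipairings] at hm
    rw [hP, card_product, hm.2.1, hm.2.2.1]
  · intro m hm
    rw [mem_bipairings] at hm
    rw [← hm.2.2.2, ← card_filter_eq_cut]
    congr 1
    ext ⟨a, b⟩
    simp only [mem_filter, mem_product, mem_univ, true_and]
    tauto

lemma nonempty_of_bi {p : H → Bool} {f g r : ℕ} (h : (bipairings p f g (r + 1)).Nonempty) :
    (bipairings p (f + 1) (g + 1) r).Nonempty := by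
  obtain ⟨m, hm⟩ := h
  rw [mem_bipairings] at hm
  have h1 := card_filter_eq_cut m p
  rw [hm.2.2.2] at h1
  obtain ⟨⟨a, b⟩, hq⟩ := card_pos.1 (by rw [h1]; omega)
  simp only [mem_filter, mem_univ, true_and] at hq
  refine ⟨m.erase s(a, b), ?_⟩
  rw [mem_bipairings]
  have e1 := mem_free_filter_mono hm.1 hq.1 p true
  have e2 := mem_free_filter_mono hm.1 hq.1 p false
  have e3 := cut_erase hq.1 p
  simp only [hq.2.1, hq.2.2, if_true] at e1 e2 e3
  refine ⟨hm.1.subset (erase_subset _ _), ?_, ?_, ?_⟩ <;> simp at * <;> omega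

lemma nonempty_of_mono {p : H → Bool} {f g r : ℕ} (h : (bipairings p f g r).Nonempty)
    (hf : f + r < #{h : H | p h = true}) :
    (bipairings p (f + 2) g r).Nonempty := by
  obtain ⟨m, hm⟩ := h
  rw [mem_bipairings] at hm
  have h1 := hm.1.card_free_filter p true
  rw [hm.2.1, hm.2.2.2] at h1
  obtain ⟨⟨a, b⟩, hq⟩ := card_pos.1
    (show 0 < #{q : H × H | s(q.1, q.2) ∈ m ∧ p q.1 = true ∧ p q.2 = true} by omega)
  simp only [mem_filter, mem_univ, true_and] at hq
  refine ⟨m.erase s(a, b), ?_⟩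
  rw [mem_bipairings]
  have e1 := mem_free_filter_mono hm.1 hq.1 p true
  have e2 := mem_free_filter_mono hm.1 hq.1 p false
  have e3 := cut_erase hq.1 p
  simp only [hq.2.1, hq.2.2, if_true] at e1 e2 e3
  refine ⟨hm.1.subset (erase_subset _ _), ?_, ?_, ?_⟩ <;> simp at * <;> omega

end Interpolation

/-! ### Positive semidefiniteness of an equivalence relation. -/

section Kernel

variable {α β : Type*} [DecidableEq α] [DecidableEq β] [Fintype β]

lemma sum_product_kernel (κ : α → β) (A B : Finset α) :
    ∑ q ∈ A ×ˢ B, (if κ q.1 = κ q.2 then (1 : ℝ) else 0) =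
      ∑ c, (#{a ∈ A | κ a = c} : ℝ) * #{b ∈ B | κ b = c} := by
  rw [sum_product]
  simp only [card_filter, Nat.cast_sum, sum_mul_sum]
  symm
  rw [sum_comm]
  refine sum_congr rfl fun a _ => ?_
  rw [sum_comm]
  refine sum_congr rfl fun b _ => ?_
  simp [eq_comm]

/-- With x and y the frequencies of the classes in `A` and `B`, this is `2 * x * y ≤ x ^ 2 + y ^ 2`
summed over the classes. -/
lemma two_mul_kernel_le (κ : α → β) {A B : Finset α} (hA : A.Nonempty) (hB : B.Nonempty) :
    2 * ((∑ q ∈ A ×ˢ B, if κ q.1 = κ q.2 then (1 : ℝ) else 0) / (#A * #B)) ≤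
      (∑ q ∈ A ×ˢ A, if κ q.1 = κ q.2 then (1 : ℝ) else 0) / (#A * #A) +
      (∑ q ∈ B ×ˢ B, if κ q.1 = κ q.2 then (1 : ℝ) else 0) / (#B * #B) := by
  have a0 : (0 : ℝ) < #A := by exact_mod_cast card_pos.2 hA
  have b0 : (0 : ℝ) < #B := by exact_mod_cast card_pos.2 hB
  simp only [sum_product_kernel, sum_div, mul_sum, ← sum_add_distrib]
  refine sum_le_sum fun c _ => ?_
  set x : ℝ := ((#{a ∈ A | κ a = c} : ℕ) : ℝ)
  set y : ℝ := ((#{b ∈ B | κ b = c} : ℕ) : ℝ)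
  have : 0 ≤ (x / #A - y / #B) ^ 2 := sq_nonneg _
  have e : (x / #A - y / #B) ^ 2 =
    x * x / (#A * #A) + y * y / (#B * #B) - 2 * (x * y / (#A * #B)) := by
    field_simp
    ring
  linarith

/-- The true pairs have distinct ends, whereas the quadratic form includes the diagonal; the
correction for sampling without replacement is at most `1 / (#A - 1)`. -/
lemma expect_offDiag_kernel_le (κ : α → β) {A : Finset α} (hA : 2 ≤ #A) :
    A.offDiag.expect (fun q => if κ q.1 = κ q.2 then (0 : ℝ) else 1) ≤
      1 - (∑ q ∈ A ×ˢ A, if κ q.1 = κ q.2 then (1 : ℝ) else 0) / (#A * #A) +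
        1 / ((#A : ℝ) - 1) := by
  have a0 : (2 : ℝ) ≤ #A := by exact_mod_cast hA
  rw [expect_eq_sum_div_card, offDiag_card, Nat.cast_sub (by nlinarith)]
  have e1 : ∑ q ∈ A.offDiag, (if κ q.1 = κ q.2 then (0 : ℝ) else 1) =
      ∑ q ∈ A ×ˢ A, (1 - if κ q.1 = κ q.2 then (1 : ℝ) else 0) := by
    rw [← diag_union_offDiag, sum_union (disjoint_diag_offDiag A)]
    have : ∑ q ∈ A.diag, (1 - if κ q.1 = κ q.2 then (1 : ℝ) else 0) = 0 := by
      refine sum_eq_zero fun q hq => ?_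
      rw [mem_diag] at hq
      simp [hq.2]
    rw [this, zero_add]
    refine sum_congr rfl fun q _ => ?_
    split_ifs <;> simp
  rw [e1, sum_sub_distrib, sum_const, card_product]
  set Q := ∑ q ∈ A ×ˢ A, if κ q.1 = κ q.2 then (1 : ℝ) else 0 with hQ
  have hQ0 : 0 ≤ Q := sum_nonneg fun q _ => by split_ifs <;> simp
  push_cast
  simp only [nsmul_eq_mul, mul_one, Nat.cast_mul]
  set a : ℝ := ((#A : ℕ) : ℝ)
  have h1 : a * a - a = a * (a - 1) := by ring
  rw [h1]
  have h2 : (a * a - Q) / (a * (a - 1)) = 1 - Q / (a * a) + 1 / (a - 1) - Q / (a * a * (a - 1)) := by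
    have : a - 1 ≠ 0 := by linarith
    have : a ≠ 0 := by linarith
    field_simp
    ring
  have : 0 ≤ Q / (a * a * (a - 1)) := by
    have : 0 < a - 1 := by linarith
    positivity
  linarith

lemma expect_kernel_le (κ : α → β) {A B : Finset α} (hA : 2 ≤ #A) (hB : 2 ≤ #B) :
    A.offDiag.expect (fun q => if κ q.1 = κ q.2 then (0 : ℝ) else 1) +
      B.offDiag.expect (fun q => if κ q.1 = κ q.2 then (0 : ℝ) else 1) ≤
      2 * (A ×ˢ B).expect (fun q => if κ q.1 = κ q.2 then (0 : ℝ) else 1) +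
        1 / ((#A : ℝ) - 1) + 1 / ((#B : ℝ) - 1) := by
  have hA' : A.Nonempty := card_pos.1 (by omega)
  have hB' : B.Nonempty := card_pos.1 (by omega)
  have h1 := expect_offDiag_kernel_le κ hA
  have h2 := expect_offDiag_kernel_le κ hB
  have h3 := two_mul_kernel_le κ hA' hB'
  have h4 : (A ×ˢ B).expect (fun q => if κ q.1 = κ q.2 then (0 : ℝ) else 1) =
      1 - (∑ q ∈ A ×ˢ B, if κ q.1 = κ q.2 then (1 : ℝ) else 0) / (#A * #B) := by
    rw [expect_eq_sum_div_card, card_product]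
    have a0 : (0 : ℝ) < #A := by exact_mod_cast card_pos.2 hA'
    have b0 : (0 : ℝ) < #B := by exact_mod_cast card_pos.2 hB'
    have : ∑ q ∈ A ×ˢ B, (if κ q.1 = κ q.2 then (0 : ℝ) else 1) =
        ∑ q ∈ A ×ˢ B, (1 - if κ q.1 = κ q.2 then (1 : ℝ) else 0) :=
      sum_congr rfl fun q _ => by split_ifs <;> simp
    rw [this, sum_sub_distrib, sum_const, card_product]
    push_cast
    simp only [nsmul_eq_mul, mul_one, Nat.cast_mul]
    rw [sub_div, div_self (by positivity)]
  rw [h4]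
  linarith

end Kernel

/-! ### The interpolation between split and complete pairings. -/

section Interpolation

variable {H : Type*} [DecidableEq H] [Fintype H]

/-- The mean of `maxCut T` over `bipairings p f g r`. -/
noncomputable def biMaxCut (p : H → Bool) (T : Finset (H → Bool)) (f g r : ℕ) : ℝ :=
  (bipairings p f g r).expect fun m => (maxCut T m : ℝ)

variable {p : H → Bool} {T : Finset (H → Bool)}

lemma biMaxCut_not (f g r : ℕ) :
    biMaxCut (fun h => !p h) T f g r = biMaxCut p T g f r := by
  rw [biMaxCut, bipairings_not, biMaxCut]

lemma biMaxCut_mono_eq (hT : T.Nonempty) {f g r : ℕ}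
    (hS : (bipairings p (f + 2) g r).Nonempty) :
    biMaxCut p T f g r = (bipairings p (f + 2) g r).expect fun m => (maxCut T m : ℝ) +
      (Finset.offDiag {h ∈ free m | p h = true}).expect
          fun q => if optClass T m q.1 = optClass T m q.2 then 0 else 1 := by
  rw [biMaxCut, (expect_insert_mono p f g r hS).2]
  refine expect_congr rfl fun m hm => ?_
  rw [mem_bipairings] at hm
  have : (Finset.offDiag {h ∈ free m | p h = true}).Nonempty := by
    rw [← card_pos, offDiag_card, hm.2.1, Nat.sub_pos_iff_lt]
    nlinarith
  rw [← expect_const this (maxCut T m : ℝ), ← expect_add_distrib]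
  refine expect_congr rfl fun q hq => ?_
  simp only [mem_offDiag, mem_filter] at hq
  rw [maxCut_insert hT (notMem_of_mem_free hq.1.1)]
  push_cast
  rfl

lemma biMaxCut_mono_eq' (hT : T.Nonempty) {f g r : ℕ}
    (hS : (bipairings p f (g + 2) r).Nonempty) :
    biMaxCut p T f g r = (bipairings p f (g + 2) r).expect fun m => (maxCut T m : ℝ) +
      (Finset.offDiag {h ∈ free m | p h = false}).expect
          fun q => if optClass T m q.1 = optClass T m q.2 then 0 else 1 := by
  have := biMaxCut_mono_eq (p := fun h => !p h) hT (f := g) (g := f) (r := r)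
    (by rwa [bipairings_not])
  rw [biMaxCut_not, bipairings_not] at this
  simpa only [Bool.not_eq_true'] using this

lemma biMaxCut_bi_eq (hT : T.Nonempty) {f g r : ℕ}
    (hS : (bipairings p (f + 1) (g + 1) r).Nonempty) :
    biMaxCut p T f g (r + 1) = (bipairings p (f + 1) (g + 1) r).expect fun m =>
      (maxCut T m : ℝ) +
      (({h ∈ free m | p h = true} : Finset H) ×ˢ ({h ∈ free m | p h = false} : Finset H)).expect
          fun q => if optClass T m q.1 = optClass T m q.2 then 0 else 1 := by
  rw [biMaxCut, (expect_insert_bi p f g r hS).2]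
  refine expect_congr rfl fun m hm => ?_
  rw [mem_bipairings] at hm
  have : (({h ∈ free m | p h = true} : Finset H) ×ˢ
      ({h ∈ free m | p h = false} : Finset H)).Nonempty := by
    rw [← card_pos, card_product, hm.2.1, hm.2.2.1]
    positivity
  rw [← expect_const this (maxCut T m : ℝ), ← expect_add_distrib]
  refine expect_congr rfl fun q hq => ?_
  simp only [mem_product, mem_filter] at hq
  rw [maxCut_insert hT (notMem_of_mem_free hq.1.1)]
  push_cast
  rfl

lemma expect_ite_mem_Icc {ι : Type*} (s : Finset ι) (P : ι → Prop) [DecidablePred P] :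
    0 ≤ s.expect (fun q => if P q then (0 : ℝ) else 1) ∧
      s.expect (fun q => if P q then (0 : ℝ) else 1) ≤ 1 := by
  constructor
  · exact expect_nonneg fun q _ => by split_ifs <;> simp
  · rcases s.eq_empty_or_nonempty with rfl | hs
    · simp
    · exact expect_le hs fun q _ => by split_ifs <;> simp

lemma expect_add_mem_Icc {ι : Type*} {s : Finset ι} (hs : s.Nonempty) (φ ψ : ι → ℝ)
    (h : ∀ i ∈ s, 0 ≤ ψ i ∧ ψ i ≤ 1) :
    s.expect φ ≤ s.expect (fun i => φ i + ψ i) ∧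
      s.expect (fun i => φ i + ψ i) ≤ s.expect φ + 1 := by
  rw [expect_add_distrib]
  have h1 : 0 ≤ s.expect ψ := expect_nonneg fun i hi => (h i hi).1
  have h2 : s.expect ψ ≤ 1 := expect_le hs fun i hi => (h i hi).2
  constructor <;> linarith

lemma biMaxCut_mono (hT : T.Nonempty) {f g r : ℕ} (hS : (bipairings p (f + 2) g r).Nonempty) :
    biMaxCut p T (f + 2) g r ≤ biMaxCut p T f g r ∧
      biMaxCut p T f g r ≤ biMaxCut p T (f + 2) g r + 1 := by
  rw [biMaxCut_mono_eq hT hS]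
  exact expect_add_mem_Icc hS _ _ fun m _ => expect_ite_mem_Icc _ _

lemma biMaxCut_mono' (hT : T.Nonempty) {f g r : ℕ} (hS : (bipairings p f (g + 2) r).Nonempty) :
    biMaxCut p T f (g + 2) r ≤ biMaxCut p T f g r ∧
      biMaxCut p T f g r ≤ biMaxCut p T f (g + 2) r + 1 := by
  rw [biMaxCut_mono_eq' hT hS]
  exact expect_add_mem_Icc hS _ _ fun m _ => expect_ite_mem_Icc _ _

lemma biMaxCut_bi (hT : T.Nonempty) {f g r : ℕ}
    (hS : (bipairings p f g (r + 1)).Nonempty) :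
    biMaxCut p T (f + 1) (g + 1) r ≤ biMaxCut p T f g (r + 1) ∧
      biMaxCut p T f g (r + 1) ≤ biMaxCut p T (f + 1) (g + 1) r + 1 := by
  rw [biMaxCut_bi_eq hT (nonempty_of_bi hS)]
  exact expect_add_mem_Icc (nonempty_of_bi hS) _ _ fun m _ => expect_ite_mem_Icc _ _

/-- All three means arise from the same uniform pairing with `f + 2` and `g + 2` free points by
adding one random pair, so the kernel inequality for `optClass T m` compares them pairing by
pairing. -/
lemma le_biMaxCut_bi (hT : T.Nonempty) {f g r D : ℕ} (hD : 0 < D) (hf : D ≤ f + 1)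
    (hg : D ≤ g + 1) (hS : (bipairings p (f + 2) (g + 2) r).Nonempty) :
    (biMaxCut p T f (g + 2) r + biMaxCut p T (f + 2) g r) / 2 - 1 / D ≤
      biMaxCut p T (f + 1) (g + 1) (r + 1) := by
  rw [biMaxCut_mono_eq hT hS, biMaxCut_mono_eq' hT hS, biMaxCut_bi_eq hT hS]
  have hD' : (0 : ℝ) < D := by exact_mod_cast hD
  have key : ∀ m ∈ bipairings p (f + 2) (g + 2) r, _ := fun m hm => by
    rw [mem_bipairings] at hm
    exact expect_kernel_le (optClass T m) (A := {h ∈ free m | p h = true})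
      (B := {h ∈ free m | p h = false}) (by omega) (by omega)
  have key2 : ∀ m ∈ bipairings p (f + 2) (g + 2) r,
    1 / (((#{h ∈ free m | p h = true} : ℕ) : ℝ) - 1) +
      1 / (((#{h ∈ free m | p h = false} : ℕ) : ℝ) - 1) ≤ 2 / D := by
    intro m hm
    rw [mem_bipairings] at hm
    rw [hm.2.1, hm.2.2.1]
    have h1 : (D : ℝ) ≤ f + 1 := by exact_mod_cast hf
    have h2 : (D : ℝ) ≤ g + 1 := by exact_mod_cast hg
    have e1 : ((f + 2 : ℕ) : ℝ) - 1 = f + 1 := by push_cast; ring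
    have e2 : ((g + 2 : ℕ) : ℝ) - 1 = g + 1 := by push_cast; ring
    rw [e1, e2]
    have := one_div_le_one_div_of_le hD' h1
    have := one_div_le_one_div_of_le hD' h2
    have : (2 : ℝ) / D = 1 / D + 1 / D := by ring
    linarith
  rw [← expect_add_distrib, expect_div, ← expect_const hS (1 / (D : ℝ)), ← expect_sub_distrib]
  refine expect_le_expect fun m hm => ?_
  have h1 := key m hm
  have h2 := key2 m hm
  have : (2 : ℝ) / D = 2 * (1 / D) := by ring
  linarith

/-- Removing monochromatic `true` pairs raises `f` by two at a time until only bichromatic pairs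
cover points of colour `true`. -/
lemma exists_add_of_nonempty {f g r : ℕ} (h : (bipairings p f g r).Nonempty) :
    ∃ j, f + r + 2 * j = #{h : H | p h = true} := by
  obtain ⟨n, hn⟩ : ∃ n, n = #{h : H | p h = true} - f := ⟨_, rfl⟩
  induction n using Nat.strong_induction_on generalizing f with
  | _ n ih =>
  have hle : f + r ≤ #{h : H | p h = true} := by
    obtain ⟨m, hm⟩ := h
    rw [mem_bipairings] at hm
    have := hm.1.card_free_filter p true
    omega
  rcases hle.eq_or_lt with h1 | h1
  · exact ⟨0, h1⟩
  · obtain ⟨j, hj⟩ := ih _ (by omega) (nonempty_of_mono h h1) rfl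
    exact ⟨j + 1, by omega⟩

lemma exists_add_of_nonempty' {f g r : ℕ} (h : (bipairings p f g r).Nonempty) :
    ∃ j, g + r + 2 * j = #{h : H | p h = false} := by
  rw [← bipairings_not] at h
  simpa only [Bool.not_eq_true'] using exists_add_of_nonempty h

lemma biMaxCut_mono_iter (hT : T.Nonempty) {f g r : ℕ} (j : ℕ)
    (h : (bipairings p (f + 2 * j) g r).Nonempty) :
    (bipairings p f g r).Nonempty ∧ biMaxCut p T (f + 2 * j) g r ≤ biMaxCut p T f g r ∧
      biMaxCut p T f g r ≤ biMaxCut p T (f + 2 * j) g r + j := by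
  induction j generalizing f with
  | zero => simpa using h
  | succ j ih =>
    have h1 := ih (f := f + 2) (by rwa [show f + 2 + 2 * j = f + 2 * (j + 1) by ring])
    rw [show f + 2 + 2 * j = f + 2 * (j + 1) by ring] at h1
    have h2 := biMaxCut_mono hT h1.1
    refine ⟨(expect_insert_mono p f g r h1.1).1, ?_, ?_⟩
    · linarith
    · push_cast
      linarith

lemma biMaxCut_mono_iter' (hT : T.Nonempty) {f g r : ℕ} (j : ℕ)
    (h : (bipairings p f (g + 2 * j) r).Nonempty) :
    (bipairings p f g r).Nonempty ∧ biMaxCut p T f (g + 2 * j) r ≤ biMaxCut p T f g r ∧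
      biMaxCut p T f g r ≤ biMaxCut p T f (g + 2 * j) r + j := by
  rw [← bipairings_not] at h
  simpa only [bipairings_not, biMaxCut_not] using biMaxCut_mono_iter hT j h

lemma biMaxCut_bi_iter (hT : T.Nonempty) {f g r : ℕ} (j : ℕ)
    (h : (bipairings p f g (r + j)).Nonempty) :
    (bipairings p (f + j) (g + j) r).Nonempty ∧
      biMaxCut p T (f + j) (g + j) r ≤ biMaxCut p T f g (r + j) ∧
      biMaxCut p T f g (r + j) ≤ biMaxCut p T (f + j) (g + j) r + j := by
  induction j generalizing f g with
  | zero => simpa using h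
  | succ j ih =>
    have h0 : (bipairings p (f + 1) (g + 1) (r + j)).Nonempty := nonempty_of_bi h
    have h1 := ih h0
    rw [show f + 1 + j = f + (j + 1) by ring, show g + 1 + j = g + (j + 1) by ring] at h1
    have h2 := biMaxCut_bi hT (r := r + j) h
    rw [← add_assoc r]
    refine ⟨h1.1, ?_, ?_⟩
    · linarith
    · push_cast
      linarith

/-- The mean of `maxCut T` over the pairings that are complete inside each colour class of `p`. -/
noncomputable def splitMaxCut (p : H → Bool) (T : Finset (H → Bool)) : ℝ :=
  biMaxCut p T (#{h : H | p h = true} % 2) (#{h : H | p h = false} % 2) 0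

/-- The crude comparison: deleting the `r` bichromatic pairs does not raise the mean, and completing
both sides then adds at most `(f + r) / 2 + (g + r) / 2` pairs, each worth at most 1. -/
lemma splitMaxCut_sub_le (hT : T.Nonempty) {f g r : ℕ} (h : (bipairings p f g r).Nonempty) :
    splitMaxCut p T - ((f : ℝ) + g) / 2 - r ≤ biMaxCut p T f g r := by
  have h1 := biMaxCut_bi_iter hT (r := 0) r (by rwa [zero_add])
  rw [zero_add] at h1
  obtain ⟨j, hj⟩ := exists_add_of_nonempty h1.1
  obtain ⟨k, hk⟩ := exists_add_of_nonempty' h1.1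
  have e1 : #{h : H | p h = true} % 2 + 2 * ((f + r) / 2) = f + r := by omega
  have e2 : #{h : H | p h = false} % 2 + 2 * ((g + r) / 2) = g + r := by omega
  have h2 := biMaxCut_mono_iter hT ((f + r) / 2) (f := #{h : H | p h = true} % 2)
    (g := g + r) (r := 0) (by rw [e1]; exact h1.1)
  have h3 := biMaxCut_mono_iter' hT ((g + r) / 2) (f := #{h : H | p h = true} % 2)
    (g := #{h : H | p h = false} % 2) (r := 0) (by rw [e2]; exact h2.1)
  rw [e1] at h2
  rw [e2] at h3
  have c1 : (((f + r) / 2 : ℕ) : ℝ) ≤ ((f : ℝ) + r) / 2 := by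
    exact_mod_cast Nat.cast_div_le (m := f + r) (n := 2) (α := ℝ)
  have c2 : (((g + r) / 2 : ℕ) : ℝ) ≤ ((g : ℝ) + r) / 2 := by
    exact_mod_cast Nat.cast_div_le (m := g + r) (n := 2) (α := ℝ)
  unfold splitMaxCut
  linarith

/-- Lowering `r` by one replaces `f` by `f - 1` or `f + 1` with equal weight, while `f + g` is
fixed. The potential `(f - f₀) ^ 2` grows by exactly 1 per step on average and pays for the walks
that leave the window of radius `D`, outside which the supply of free points is no longer
controlled. -/
lemma interpolation_bound (hT : T.Nonempty) {D R f₀ g₀ : ℕ} (hD : 0 < D) (hf₀ : 2 * D ≤ f₀)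
    (hg₀ : 2 * D ≤ g₀) {f g r : ℕ} (hr : r ≤ R) (hfg : f + g = f₀ + g₀)
    (h : (bipairings p f g r).Nonempty) :
    splitMaxCut p T - ((f₀ : ℝ) + g₀) / 2 - (R / D ^ 2) * ((f : ℝ) - f₀) ^ 2
      - (R / D ^ 2 + 1 / D) * r ≤ biMaxCut p T f g r := by
  have hD' : (0 : ℝ) < D := by exact_mod_cast hD
  have hl : (0 : ℝ) ≤ (R : ℝ) / D ^ 2 := by positivity
  induction r generalizing f g with
  | zero =>
    have h1 := splitMaxCut_sub_le hT h
    have e : (f : ℝ) + g = f₀ + g₀ := by exact_mod_cast hfg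
    rw [e] at h1
    have : 0 ≤ ((R : ℝ) / D ^ 2) * ((f : ℝ) - f₀) ^ 2 := by positivity
    push_cast at h1 ⊢
    linarith
  | succ r ih =>
    -- Outside the window the quadratic penalty is at least `R`, which covers the loss `r` of the
    -- crude comparison; inside it, both sides keep enough free points for an error of `1 / D`.
    by_cases hy : f₀ + D ≤ f ∨ f + D ≤ f₀
    · have h1 := splitMaxCut_sub_le hT h
      have e : (f : ℝ) + g = f₀ + g₀ := by exact_mod_cast hfg
      rw [e] at h1
      have h2 : (D : ℝ) ^ 2 ≤ ((f : ℝ) - f₀) ^ 2 := by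
        rw [sq_le_sq, abs_of_pos hD', le_abs]
        rcases hy with hy | hy
        · left
          have : (f₀ : ℝ) + D ≤ f := by exact_mod_cast hy
          linarith
        · right
          have : (f : ℝ) + D ≤ f₀ := by exact_mod_cast hy
          linarith
      have h3 : (R : ℝ) ≤ ((R : ℝ) / D ^ 2) * ((f : ℝ) - f₀) ^ 2 := by
        calc (R : ℝ) = ((R : ℝ) / D ^ 2) * D ^ 2 := by field_simp
          _ ≤ _ := mul_le_mul_of_nonneg_left h2 hl
      have h4 : ((r + 1 : ℕ) : ℝ) ≤ R := by exact_mod_cast hr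
      have h5 : 0 ≤ ((R : ℝ) / D ^ 2 + 1 / D) * ((r + 1 : ℕ) : ℝ) := by positivity
      linarith
    · push Not at hy
      obtain ⟨f', rfl⟩ : ∃ f', f = f' + 1 := ⟨f - 1, by omega⟩
      obtain ⟨g', rfl⟩ : ∃ g', g = g' + 1 := ⟨g - 1, by omega⟩
      have hb := nonempty_of_bi h
      have key := le_biMaxCut_bi hT hD (by omega) (by omega) hb
      have n1 := (expect_insert_mono p f' (g' + 2) r hb).1
      have n2 : (bipairings p (f' + 2) g' r).Nonempty := by
        rw [← bipairings_not] at hb ⊢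
        exact (expect_insert_mono _ g' (f' + 2) r hb).1
      have i1 := ih (by omega) (by omega) n1
      have i2 := ih (by omega) (by omega) n2
      push_cast at i1 i2 ⊢
      -- With `y = f - f₀`, the mean of `(y - 1) ^ 2` and `(y + 1) ^ 2` is `y ^ 2 + 1`; this and the
      -- error `1 / D` make up the coefficient of `r`.
      nlinarith

lemma splitMaxCut_le_of_complete (hT : T.Nonempty) {D R : ℕ} (hD : 0 < D) {f g r : ℕ}
    (hr : r ≤ R) (hfg : f + g ≤ 1) (h : (bipairings p f g r).Nonempty) :
    splitMaxCut p T - (2 * D + 1) - ((R : ℝ) / D ^ 2 + 1 / D) * R ≤ biMaxCut p T f g r := by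
  have hD' : (0 : ℝ) < D := by exact_mod_cast hD
  have h0 : (0 : ℝ) ≤ ((R : ℝ) / D ^ 2 + 1 / D) := by positivity
  have hfg' : (f : ℝ) + g ≤ 1 := by exact_mod_cast hfg
  rcases le_total r (2 * D) with h1 | h1
  · have h2 := splitMaxCut_sub_le hT h
    have h3 : (r : ℝ) ≤ 2 * D := by exact_mod_cast h1
    have : 0 ≤ ((R : ℝ) / D ^ 2 + 1 / D) * R := by positivity
    linarith
  -- A complete pairing has no spare free points. Deleting `2 * D` bichromatic pairs creates `2 * D`
  -- of them on each side, at the centre of the window.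
  · obtain ⟨s, rfl⟩ := Nat.exists_eq_add_of_le' h1
    have h2 := biMaxCut_bi_iter hT (2 * D) h
    have h3 := interpolation_bound hT hD (f₀ := f + 2 * D) (g₀ := g + 2 * D) (R := R)
      (by omega) (by omega) (by omega) rfl h2.1
    have h4 : ((R : ℝ) / D ^ 2 + 1 / D) * s ≤ ((R : ℝ) / D ^ 2 + 1 / D) * R :=
      mul_le_mul_of_nonneg_left (by exact_mod_cast (by omega)) h0
    rw [sub_self] at h3
    push_cast at h3
    linarith

end Interpolation

/-! ### Transport of pairings along injections. -/

section Image

variable {H K : Type*} [DecidableEq H] [DecidableEq K]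

/-- The image of a set of pairs under a map of the underlying points. -/
def mapPairs (ι : H → K) (m : Finset (Sym2 H)) : Finset (Sym2 K) := m.image (Sym2.map ι)

lemma mem_mapPairs {ι : H → K} {m : Finset (Sym2 H)} {e : Sym2 K} :
    e ∈ mapPairs ι m ↔ ∃ e' ∈ m, e'.map ι = e := by simp [mapPairs]

lemma map_mem_mapPairs {ι : H → K} (hι : ι.Injective) {m : Finset (Sym2 H)} {e : Sym2 H} :
    e.map ι ∈ mapPairs ι m ↔ e ∈ m := by
  rw [mem_mapPairs]
  exact ⟨fun ⟨e', h, h'⟩ => Sym2.map.injective hι h' ▸ h, fun h => ⟨e, h, rfl⟩⟩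

lemma card_mapPairs {ι : H → K} (hι : ι.Injective) (m : Finset (Sym2 H)) :
    #(mapPairs ι m) = #m := card_image_of_injective _ (Sym2.map.injective hι)

lemma IsPairing.mapPairs {ι : H → K} (hι : ι.Injective) {m : Finset (Sym2 H)}
    (hm : IsPairing m) : IsPairing (mapPairs ι m) := by
  constructor
  · intro e he
    obtain ⟨e', h, rfl⟩ := mem_mapPairs.1 he
    rw [Sym2.isDiag_map hι]
    exact hm.1 e' h
  · intro e he f hf k hke hkf
    obtain ⟨e', he', rfl⟩ := mem_mapPairs.1 he
    obtain ⟨f', hf', rfl⟩ := mem_mapPairs.1 hf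
    obtain ⟨h, h1, rfl⟩ := Sym2.mem_map.1 hke
    obtain ⟨h', h2, h3⟩ := Sym2.mem_map.1 hkf
    rw [hι h3] at h2
    rw [hm.2 e' he' f' hf' h h1 h2]

lemma IsPairing.comap [Fintype H] {ι : H → K} (hι : ι.Injective) {m : Finset (Sym2 K)}
    (hm : IsPairing m) : IsPairing (Finset.univ.filter fun e : Sym2 H => e.map ι ∈ m) := by
  constructor
  · intro e he
    rw [← Sym2.isDiag_map hι]
    exact hm.1 _ (mem_filter.1 he).2
  · intro e he f hf x hxe hxf
    exact Sym2.map.injective hι (hm.2 _ (mem_filter.1 he).2 _ (mem_filter.1 hf).2 (ι x)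
      (Sym2.mem_map.2 ⟨x, hxe, rfl⟩) (Sym2.mem_map.2 ⟨x, hxf, rfl⟩))

lemma cut_mapPairs {ι : H → K} (hι : ι.Injective) (m : Finset (Sym2 H)) (τ : K → Bool) :
    cut τ (mapPairs ι m) = cut (τ ∘ ι) m := by
  unfold cut mapPairs
  rw [filter_image, card_image_of_injective _ (Sym2.map.injective hι)]
  simp only [Sym2.map_map]

lemma mapPairs_mapPairs {L : Type*} [DecidableEq L] (ι : H → K) (κ : K → L)
    (m : Finset (Sym2 H)) : mapPairs κ (mapPairs ι m) = mapPairs (κ ∘ ι) m := by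
  unfold mapPairs
  rw [image_image, Sym2.map_comp]

lemma mapPairs_id (m : Finset (Sym2 H)) : mapPairs id m = m := by
  simp [mapPairs]

lemma maxCut_mapPairs [Fintype H] {ι : H → K} (hι : ι.Injective) (m : Finset (Sym2 H))
    (T : Finset (K → Bool)) :
    maxCut T (mapPairs ι m) = maxCut (T.image fun τ => τ ∘ ι) m := by
  unfold maxCut
  rw [sup_image]
  exact sup_congr rfl fun τ _ => cut_mapPairs hι m τ

end Image

/-! ### Complete pairings. -/

section Complete

variable {H : Type*} [DecidableEq H] [Fintype H]

open scoped Classical in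
/-- The pairings that leave exactly `f` points uncovered. -/
noncomputable def pairings (H : Type*) [DecidableEq H] [Fintype H] (f : ℕ) :
    Finset (Finset (Sym2 H)) := {m | IsPairing m ∧ #(free m) = f}

lemma mem_pairings {f : ℕ} {m : Finset (Sym2 H)} :
    m ∈ pairings H f ↔ IsPairing m ∧ #(free m) = f := by simp [pairings]

lemma mem_pairings_mod {m : Finset (Sym2 H)} :
    m ∈ pairings H (Fintype.card H % 2) ↔ IsPairing m ∧ #m = Fintype.card H / 2 := by
  rw [mem_pairings]
  constructor <;> rintro ⟨h1, h2⟩ <;> refine ⟨h1, ?_⟩ <;> have := h1.card_free <;> omega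

lemma mem_pairings_card {m : Finset (Sym2 H)} : m ∈ pairings H (Fintype.card H) ↔ m = ∅ := by
  rw [mem_pairings]
  constructor
  · rintro ⟨h1, h2⟩
    have := h1.card_free
    exact card_eq_zero.1 (by omega)
  · rintro rfl
    exact ⟨isPairing_empty, by simp [free]⟩

/-- The mean of `maxCut T` over the complete pairings. -/
noncomputable def avgMaxCut (T : Finset (H → Bool)) : ℝ :=
  (pairings H (Fintype.card H % 2)).expect fun m => (maxCut T m : ℝ)

lemma card_free_filter_add (p : H → Bool) (m : Finset (Sym2 H)) :
    #{h ∈ free m | p h = true} + #{h ∈ free m | p h = false} = #(free m) := by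
  rw [← card_filter_add_card_filter_not (s := free m) (fun h => p h = true)]
  simp

lemma pairings_mod_nonempty (H : Type*) [DecidableEq H] [Fintype H] :
    (pairings H (Fintype.card H % 2)).Nonempty := by
  -- With a single colour, completing the empty pairing by monochromatic pairs yields a complete
  -- pairing.
  have h0 : (bipairings (fun _ : H => true) (Fintype.card H % 2 + 2 * (Fintype.card H / 2))
      0 0).Nonempty := by
    refine ⟨∅, ?_⟩
    rw [mem_bipairings]
    refine ⟨isPairing_empty, ?_, ?_, ?_⟩
    · rw [Nat.mod_add_div]
      simp [free]
    · simp
    · simp [cut]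
  obtain ⟨m, hm⟩ := (biMaxCut_mono_iter (T := {fun _ => true}) (by simp) _ h0).1
  rw [mem_bipairings] at hm
  have := card_free_filter_add (fun _ => true) m
  exact ⟨m, mem_pairings.2 ⟨hm.1, by omega⟩⟩

lemma expect_bounds_of_fiberwise {ι κ : Type*} [DecidableEq κ] {S : Finset ι} (hS : S.Nonempty)
    (k : ι → κ) (φ : ι → ℝ) {L U : ℝ}
    (h : ∀ i ∈ S, L ≤ (S.filter fun j => k j = k i).expect φ ∧
      (S.filter fun j => k j = k i).expect φ ≤ U) :
    L ≤ S.expect φ ∧ S.expect φ ≤ U := by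
  have e : ∀ ψ : ι → ℝ, ∑ y ∈ S.image k, ∑ x ∈ S with k x = y, ψ x = ∑ x ∈ S, ψ x := fun ψ =>
    sum_fiberwise_of_maps_to (fun x hx => mem_image_of_mem k hx) ψ
  have hc : (0 : ℝ) < #S := by exact_mod_cast card_pos.2 hS
  rw [expect_eq_sum_div_card, le_div_iff₀ hc, div_le_iff₀ hc]
  have c : ∀ x : ℝ, x * #S = ∑ i ∈ S, x := fun x => by
    rw [sum_const, nsmul_eq_mul, mul_comm]
  rw [c, c, ← e, ← e, ← e]
  have key : ∀ y ∈ S.image k, ∑ x ∈ S with k x = y, L ≤ ∑ x ∈ S with k x = y, φ x ∧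
      ∑ x ∈ S with k x = y, φ x ≤ ∑ x ∈ S with k x = y, U := by
    intro y hy
    obtain ⟨i, hi, rfl⟩ := mem_image.1 hy
    have h1 := h i hi
    rw [sum_const, sum_const, ← card_smul_expect]
    exact ⟨nsmul_le_nsmul_right h1.1 _, nsmul_le_nsmul_right h1.2 _⟩
  exact ⟨sum_le_sum fun y hy => (key y hy).1, sum_le_sum fun y hy => (key y hy).2⟩

/-- Conditioned on its colour statistics, a uniform complete pairing is uniform on one of the sets
`bipairings p f g r` with `f + g ≤ 1`, so uniform bounds on those means pass to the average. -/
lemma avgMaxCut_bounds (p : H → Bool) (T : Finset (H → Bool)) {L U : ℝ}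
    (h : ∀ f g r, f + g ≤ 1 → (bipairings p f g r).Nonempty →
      L ≤ biMaxCut p T f g r ∧ biMaxCut p T f g r ≤ U) :
    L ≤ avgMaxCut T ∧ avgMaxCut T ≤ U := by
  refine expect_bounds_of_fiberwise (pairings_mod_nonempty H)
    (fun m => (#{h ∈ free m | p h = true}, #{h ∈ free m | p h = false}, cut p m)) _ ?_
  intro m hm
  rw [mem_pairings] at hm
  have e : (pairings H (Fintype.card H % 2)).filter (fun m' =>
      (#{h ∈ free m' | p h = true}, #{h ∈ free m' | p h = false}, cut p m') =
      (#{h ∈ free m | p h = true}, #{h ∈ free m | p h = false}, cut p m)) =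
      bipairings p #{h ∈ free m | p h = true} #{h ∈ free m | p h = false} (cut p m) := by
    ext m'
    have h1 := card_free_filter_add p m
    have h2 := card_free_filter_add p m'
    simp only [mem_filter, mem_pairings, mem_bipairings, Prod.mk.injEq]
    constructor
    · tauto
    · rintro ⟨a, b, c, d⟩
      exact ⟨⟨a, by omega⟩, b, c, d⟩
  rw [e]
  apply h
  · rw [card_free_filter_add]
    omega
  · exact ⟨m, mem_bipairings.2 ⟨hm.1, rfl, rfl, rfl⟩⟩

lemma avgMaxCut_nonneg (T : Finset (H → Bool)) : 0 ≤ avgMaxCut T :=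
  expect_nonneg fun _ _ => Nat.cast_nonneg _

lemma avgMaxCut_le (T : Finset (H → Bool)) : avgMaxCut T ≤ Fintype.card H := by
  refine expect_le (pairings_mod_nonempty H) fun m hm => ?_
  rw [mem_pairings_mod] at hm
  have := maxCut_le_card T m
  exact_mod_cast (by omega)

lemma splitMaxCut_sub_le_avgMaxCut {p : H → Bool} {T : Finset (H → Bool)} (hT : T.Nonempty)
    {D : ℕ} (hD : 0 < D) {R : ℕ} (hR : #{h : H | p h = true} ≤ R) :
    splitMaxCut p T - (2 * D + 1) - ((R : ℝ) / D ^ 2 + 1 / D) * R ≤ avgMaxCut T := by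
  refine (avgMaxCut_bounds p T (U := Fintype.card H) fun f g r hfg h => ⟨?_, ?_⟩).1
  · obtain ⟨j, hj⟩ := exists_add_of_nonempty h
    exact splitMaxCut_le_of_complete hT hD (by omega) hfg h
  · refine expect_le h fun m hm => ?_
    have h1 := (mem_bipairings.1 hm).1.card_free
    have h2 := maxCut_le_card T m
    exact_mod_cast (by omega)

/-- Both means are joined by adding and removing pairs that touch the `false` class, at a cost of 1
each, and by completing the `true` class, whose monotonicity is used only in the favourable
direction. This yields the Lipschitz dependence on the degrees. -/
lemma abs_avgMaxCut_sub_biMaxCut_le {p : H → Bool} {T : Finset (H → Bool)} (hT : T.Nonempty) :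
    |avgMaxCut T - biMaxCut p T (#{h : H | p h = true} % 2) #{h : H | p h = false} 0| ≤
      #{h : H | p h = false} + 1 := by
  set n₁ := #{h : H | p h = true}
  set n₂ := #{h : H | p h = false}
  have h0 : (bipairings p (n₁ % 2 + 2 * (n₁ / 2)) (n₂ % 2 + 2 * (n₂ / 2)) 0).Nonempty := by
    rw [Nat.mod_add_div, Nat.mod_add_div]
    refine ⟨∅, mem_bipairings.2 ⟨isPairing_empty, ?_, ?_, ?_⟩⟩
    · simp [free, n₁]
    · simp [free, n₂]
    · simp [cut]
  have h1 := biMaxCut_mono_iter hT _ h0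
  have h2 := biMaxCut_mono_iter' hT _ h1.1
  rw [abs_le]
  have := avgMaxCut_bounds p T (L := biMaxCut p T (n₁ % 2) n₂ 0 - (n₂ + 1))
    (U := biMaxCut p T (n₁ % 2) n₂ 0 + (n₂ + 1)) ?_
  · constructor <;> linarith [this.1, this.2]
  intro f g r hfg h
  obtain ⟨k, hk⟩ := exists_add_of_nonempty' h
  have hr : r ≤ n₂ := by omega
  have hr' : (r : ℝ) ≤ n₂ := by exact_mod_cast hr
  have hfg' : (f : ℝ) + g ≤ 1 := by exact_mod_cast hfg
  constructor
  · have h3 := splitMaxCut_sub_le hT h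
    have h4 := h2.2.1
    rw [Nat.mod_add_div] at h4
    have : splitMaxCut p T = biMaxCut p T (n₁ % 2) (n₂ % 2) 0 := rfl
    linarith
  · have h3 := biMaxCut_bi_iter hT (r := 0) r (by rwa [zero_add])
    rw [zero_add] at h3
    have h5 : ∀ j f g, g + 2 * j = n₂ → (bipairings p f g 0).Nonempty →
        (bipairings p f n₂ 0).Nonempty ∧ biMaxCut p T f g 0 ≤ biMaxCut p T f n₂ 0 + j := by
      intro j
      induction j with
      | zero =>
        rintro f g rfl h
        simpa using h
      | succ j ih =>
        intro f g hj h
        have n1 : (bipairings p f (g + 2) 0).Nonempty := by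
          rw [← bipairings_not] at h ⊢
          refine nonempty_of_mono h ?_
          simp only [Bool.not_eq_true']
          omega
        have i1 := ih f (g + 2) (by omega) n1
        have i2 := (biMaxCut_mono' hT n1).2
        refine ⟨i1.1, ?_⟩
        push_cast
        linarith
    have h6 := h5 k (f + r) (g + r) (by omega) h3.1
    obtain ⟨j, hj⟩ := exists_add_of_nonempty h3.1
    have e : n₁ % 2 + 2 * ((f + r) / 2) = f + r := by omega
    have h7 := biMaxCut_mono_iter hT ((f + r) / 2) (f := n₁ % 2) (g := n₂) (r := 0)
      (by rw [e]; exact h6.1)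
    rw [e] at h7
    have hk' : (g : ℝ) + r + 2 * k = n₂ := by exact_mod_cast hk
    have : (0 : ℝ) ≤ g := Nat.cast_nonneg g
    linarith

end Complete

/-! ### Disjoint unions and near superadditivity. -/

section Sum

variable {H₁ H₂ : Type*} [DecidableEq H₁] [Fintype H₁] [DecidableEq H₂] [Fintype H₂]

/-- The union of a pairing of `H₁` and a pairing of `H₂`, as a pairing of `H₁ ⊕ H₂`. -/
def joinPairs (m₁ : Finset (Sym2 H₁)) (m₂ : Finset (Sym2 H₂)) : Finset (Sym2 (H₁ ⊕ H₂)) :=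
  mapPairs Sum.inl m₁ ∪ mapPairs Sum.inr m₂

lemma map_inl_ne_map_inr (e : Sym2 H₁) (f : Sym2 H₂) (x : H₁ ⊕ H₂) (hx : x ∈ e.map Sum.inl)
    (hx' : x ∈ f.map Sum.inr) : False := by
  obtain ⟨a, -, rfl⟩ := Sym2.mem_map.1 hx
  obtain ⟨b, -, h⟩ := Sym2.mem_map.1 hx'
  exact Sum.inr_ne_inl h

lemma disjoint_mapPairs (m₁ : Finset (Sym2 H₁)) (m₂ : Finset (Sym2 H₂)) :
    Disjoint (mapPairs (Sum.inl : H₁ → H₁ ⊕ H₂) m₁) (mapPairs Sum.inr m₂) := by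
  rw [Finset.disjoint_left]
  intro e h1 h2
  obtain ⟨e₁, -, rfl⟩ := mem_mapPairs.1 h1
  obtain ⟨e₂, -, h⟩ := mem_mapPairs.1 h2
  induction e₁ with | _ a b =>
  exact map_inl_ne_map_inr s(a, b) e₂ (Sum.inl a) (by simp) (by rw [h]; simp)

lemma cut_joinPairs (τ : H₁ ⊕ H₂ → Bool) (m₁ : Finset (Sym2 H₁)) (m₂ : Finset (Sym2 H₂)) :
    cut τ (joinPairs m₁ m₂) = cut (τ ∘ Sum.inl) m₁ + cut (τ ∘ Sum.inr) m₂ := by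
  rw [← cut_mapPairs Sum.inl_injective, ← cut_mapPairs Sum.inr_injective]
  unfold cut joinPairs
  rw [filter_union, card_union_of_disjoint (disjoint_filter_filter (disjoint_mapPairs m₁ m₂))]

lemma isPairing_joinPairs {m₁ : Finset (Sym2 H₁)} {m₂ : Finset (Sym2 H₂)} (h₁ : IsPairing m₁)
    (h₂ : IsPairing m₂) : IsPairing (joinPairs m₁ m₂) := by
  have h₁' := h₁.mapPairs (ι := (Sum.inl : H₁ → H₁ ⊕ H₂)) Sum.inl_injective
  have h₂' := h₂.mapPairs (ι := (Sum.inr : H₂ → H₁ ⊕ H₂)) Sum.inr_injective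
  constructor
  · intro e he
    rcases mem_union.1 he with he | he
    · exact h₁'.1 e he
    · exact h₂'.1 e he
  · intro e he f hf x hxe hxf
    rcases mem_union.1 he with he | he <;> rcases mem_union.1 hf with hf | hf
    · exact h₁'.2 e he f hf x hxe hxf
    · obtain ⟨e', -, rfl⟩ := mem_mapPairs.1 he
      obtain ⟨f', -, rfl⟩ := mem_mapPairs.1 hf
      exact (map_inl_ne_map_inr e' f' x hxe hxf).elim
    · obtain ⟨e', -, rfl⟩ := mem_mapPairs.1 he
      obtain ⟨f', -, rfl⟩ := mem_mapPairs.1 hf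
      exact (map_inl_ne_map_inr f' e' x hxf hxe).elim
    · exact h₂'.2 e he f hf x hxe hxf

lemma inl_mem_free_joinPairs {m₁ : Finset (Sym2 H₁)} {m₂ : Finset (Sym2 H₂)} {a : H₁} :
    Sum.inl a ∈ free (joinPairs m₁ m₂) ↔ a ∈ free m₁ := by
  simp [mem_free, joinPairs, mem_mapPairs, or_imp, forall_and]

lemma inr_mem_free_joinPairs {m₁ : Finset (Sym2 H₁)} {m₂ : Finset (Sym2 H₂)} {a : H₂} :
    Sum.inr a ∈ free (joinPairs m₁ m₂) ↔ a ∈ free m₂ := by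
  simp [mem_free, joinPairs, mem_mapPairs, or_imp, forall_and]

lemma card_free_joinPairs_left (m₁ : Finset (Sym2 H₁)) (m₂ : Finset (Sym2 H₂)) :
    #{h ∈ free (joinPairs m₁ m₂) | h.isLeft = true} = #(free m₁) := by
  trans #((free m₁).map (Function.Embedding.inl (β := H₂)))
  swap
  · rw [card_map]
  congr 1
  ext x
  rcases x with a | a <;> simp [inl_mem_free_joinPairs]

lemma card_free_joinPairs_right (m₁ : Finset (Sym2 H₁)) (m₂ : Finset (Sym2 H₂)) :
    #{h ∈ free (joinPairs m₁ m₂) | h.isLeft = false} = #(free m₂) := by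
  trans #((free m₂).map (Function.Embedding.inr (α := H₁)))
  swap
  · rw [card_map]
  congr 1
  ext x
  rcases x with a | a <;> simp [inr_mem_free_joinPairs]

lemma cut_isLeft_joinPairs (m₁ : Finset (Sym2 H₁)) (m₂ : Finset (Sym2 H₂)) :
    cut (fun h : H₁ ⊕ H₂ => h.isLeft) (joinPairs m₁ m₂) = 0 := by
  rw [cut_joinPairs]
  unfold cut
  simp only [Nat.add_eq_zero_iff, card_eq_zero, filter_eq_empty_iff]
  constructor <;> intro e _ <;> induction e <;> simp

lemma joinPairs_injective {m₁ m₁' : Finset (Sym2 H₁)} {m₂ m₂' : Finset (Sym2 H₂)}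
    (h : joinPairs m₁ m₂ = joinPairs m₁' m₂') : m₁ = m₁' ∧ m₂ = m₂' := by
  have hl : ∀ (m₁ : Finset (Sym2 H₁)) (m₂ : Finset (Sym2 H₂)) e,
      e.map Sum.inl ∈ joinPairs m₁ m₂ ↔ e ∈ m₁ := by
    intro m₁ m₂ e
    unfold joinPairs
    rw [mem_union, map_mem_mapPairs Sum.inl_injective, or_iff_left]
    intro h
    obtain ⟨f, -, hf⟩ := mem_mapPairs.1 h
    induction e with | _ a b =>
    exact map_inl_ne_map_inr s(a, b) f (Sum.inl a) (by simp) (by rw [hf]; simp)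
  have hr : ∀ (m₁ : Finset (Sym2 H₁)) (m₂ : Finset (Sym2 H₂)) e,
      e.map Sum.inr ∈ joinPairs m₁ m₂ ↔ e ∈ m₂ := by
    intro m₁ m₂ e
    unfold joinPairs
    rw [mem_union, map_mem_mapPairs Sum.inr_injective, or_iff_right]
    intro h
    obtain ⟨f, -, hf⟩ := mem_mapPairs.1 h
    induction e with | _ a b =>
    exact map_inl_ne_map_inr f s(a, b) (Sum.inr a) (by rw [hf]; simp) (by simp)
  constructor <;> ext e
  · rw [← hl m₁ m₂, h, hl]
  · rw [← hr m₁ m₂, h, hr]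

lemma exists_joinPairs_eq {m : Finset (Sym2 (H₁ ⊕ H₂))} (hm : IsPairing m)
    (h : cut (fun h : H₁ ⊕ H₂ => h.isLeft) m = 0) :
    ∃ m₁ m₂, IsPairing m₁ ∧ IsPairing m₂ ∧ joinPairs m₁ m₂ = m := by
  refine ⟨_, _, hm.comap Sum.inl_injective, hm.comap Sum.inr_injective, ?_⟩
  unfold cut at h
  rw [card_eq_zero, filter_eq_empty_iff] at h
  ext e
  simp only [joinPairs, mem_union, mem_mapPairs, mem_filter, mem_univ, true_and]
  constructor
  · rintro (⟨e', h', rfl⟩ | ⟨e', h', rfl⟩) <;> exact h'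
  · intro he
    have h1 := h he
    induction e with | _ x y =>
    rcases x with a | a <;> rcases y with b | b
    · exact Or.inl ⟨s(a, b), he, rfl⟩
    · simp at h1
    · simp at h1
    · exact Or.inr ⟨s(a, b), he, rfl⟩

lemma expect_bipairings_isLeft (f g : ℕ) (φ : Finset (Sym2 (H₁ ⊕ H₂)) → ℝ) :
    (bipairings (fun h : H₁ ⊕ H₂ => h.isLeft) f g 0).expect φ =
      (pairings H₁ f ×ˢ pairings H₂ g).expect fun q => φ (joinPairs q.1 q.2) := by
  symm
  refine expect_nbij (fun q => joinPairs q.1 q.2) ?_ (fun _ _ => rfl) ?_ ?_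
  · rintro ⟨m₁, m₂⟩ h
    simp only [mem_product, mem_pairings] at h
    rw [mem_bipairings, card_free_joinPairs_left, card_free_joinPairs_right,
      cut_isLeft_joinPairs]
    exact ⟨isPairing_joinPairs h.1.1 h.2.1, h.1.2, h.2.2, rfl⟩
  · rintro ⟨m₁, m₂⟩ _ ⟨m₁', m₂'⟩ _ h
    obtain ⟨rfl, rfl⟩ := joinPairs_injective h
    rfl
  · intro m hm
    have hm := mem_bipairings.1 (mem_coe.1 hm)
    obtain ⟨m₁, m₂, h₁, h₂, rfl⟩ := exists_joinPairs_eq hm.1 hm.2.2.2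
    rw [card_free_joinPairs_left, card_free_joinPairs_right] at hm
    exact ⟨(m₁, m₂), by simp [mem_pairings, h₁, h₂, hm], rfl⟩

lemma card_isLeft_true : #{h : H₁ ⊕ H₂ | h.isLeft = true} = Fintype.card H₁ := by
  trans #((Finset.univ : Finset H₁).map (Function.Embedding.inl (β := H₂)))
  swap
  · rw [card_map, card_univ]
  congr 1
  ext x
  rcases x with a | a <;> simp

lemma card_isLeft_false : #{h : H₁ ⊕ H₂ | h.isLeft = false} = Fintype.card H₂ := by
  trans #((Finset.univ : Finset H₂).map (Function.Embedding.inr (α := H₁)))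
  swap
  · rw [card_map, card_univ]
  congr 1
  ext x
  rcases x with a | a <;> simp

/-- A pairing without crossing pairs is a product, and optimal colourings of the two parts are
glued. Reversing the second one does not change its cut, so one of the two gluings lying in `T` is
enough. -/
lemma avgMaxCut_add_le_splitMaxCut {T : Finset (H₁ ⊕ H₂ → Bool)} {T₁ : Finset (H₁ → Bool)}
    {T₂ : Finset (H₂ → Bool)} (hT₁ : T₁.Nonempty) (hT₂ : T₂.Nonempty)
    (h : ∀ τ₁ ∈ T₁, ∀ τ₂ ∈ T₂, Sum.elim τ₁ τ₂ ∈ T ∨ Sum.elim τ₁ (fun x => !τ₂ x) ∈ T) :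
    avgMaxCut T₁ + avgMaxCut T₂ ≤ splitMaxCut (fun h : H₁ ⊕ H₂ => h.isLeft) T := by
  unfold splitMaxCut biMaxCut
  rw [expect_bipairings_isLeft, card_isLeft_true, card_isLeft_false]
  have e : avgMaxCut T₁ + avgMaxCut T₂ =
      (pairings H₁ (Fintype.card H₁ % 2) ×ˢ pairings H₂ (Fintype.card H₂ % 2)).expect
        fun q => (maxCut T₁ q.1 : ℝ) + maxCut T₂ q.2 := by
    rw [expect_product]
    simp only [expect_add_distrib, expect_const (pairings_mod_nonempty H₂),
      expect_const (pairings_mod_nonempty H₁)]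
    rfl
  rw [e]
  refine expect_le_expect fun q _ => ?_
  obtain ⟨τ₁, h₁, e₁⟩ := exists_cut_eq_maxCut hT₁ q.1
  obtain ⟨τ₂, h₂, e₂⟩ := exists_cut_eq_maxCut hT₂ q.2
  rw [← e₁, ← e₂]
  norm_cast
  rcases h τ₁ h₁ τ₂ h₂ with h | h
  · refine le_trans (le_of_eq ?_) (cut_le_maxCut h _)
    rw [cut_joinPairs, Sum.elim_comp_inl, Sum.elim_comp_inr]
  · refine le_trans (le_of_eq ?_) (cut_le_maxCut h _)
    rw [cut_joinPairs, Sum.elim_comp_inl, Sum.elim_comp_inr, cut_not]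

/-- The error involves only `H₁`, because every crossing pair uses one of its points. This asymmetry
lets many copies be attached one at a time at a fixed cost per copy. -/
lemma avgMaxCut_add_le {T : Finset (H₁ ⊕ H₂ → Bool)} {T₁ : Finset (H₁ → Bool)}
    {T₂ : Finset (H₂ → Bool)} (hT₁ : T₁.Nonempty) (hT₂ : T₂.Nonempty)
    (h : ∀ τ₁ ∈ T₁, ∀ τ₂ ∈ T₂, Sum.elim τ₁ τ₂ ∈ T ∨ Sum.elim τ₁ (fun x => !τ₂ x) ∈ T)
    {D : ℕ} (hD : 0 < D) :
    avgMaxCut T₁ + avgMaxCut T₂ ≤ avgMaxCut T + (2 * D + 1) +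
      ((Fintype.card H₁ : ℝ) / D ^ 2 + 1 / D) * Fintype.card H₁ := by
  have h1 := avgMaxCut_add_le_splitMaxCut hT₁ hT₂ h
  have hT : T.Nonempty := by
    obtain ⟨τ₁, h₁⟩ := hT₁
    obtain ⟨τ₂, h₂⟩ := hT₂
    rcases h τ₁ h₁ τ₂ h₂ with h | h <;> exact ⟨_, h⟩
  have h2 := splitMaxCut_sub_le_avgMaxCut (p := fun h : H₁ ⊕ H₂ => h.isLeft) hT hD
    (card_isLeft_true (H₁ := H₁) (H₂ := H₂)).le
  linarith

lemma abs_avgMaxCut_sub_le {T : Finset (H₁ ⊕ H₂ → Bool)} (hT : T.Nonempty) :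
    |avgMaxCut T - avgMaxCut (T.image fun τ => τ ∘ Sum.inl)| ≤ Fintype.card H₂ + 1 := by
  have h := abs_avgMaxCut_sub_biMaxCut_le (p := fun h : H₁ ⊕ H₂ => h.isLeft) hT
  rw [card_isLeft_true, card_isLeft_false] at h
  convert h using 4
  unfold biMaxCut
  rw [expect_bipairings_isLeft]
  -- Leaving all of `H₂` uncovered forces the empty pairing there, so what remains is the complete
  -- model on `H₁`.
  have : pairings H₂ (Fintype.card H₂) = {∅} := by
    ext m
    rw [mem_pairings_card, mem_singleton]
  rw [this, expect_product]
  simp only [expect_singleton]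
  refine expect_congr rfl fun m _ => ?_
  rw [← maxCut_mapPairs Sum.inl_injective]
  simp [joinPairs, mapPairs]

end Sum

/-! ### Invariance under relabelling. -/

section Relabel

variable {H K : Type*} [DecidableEq H] [Fintype H] [DecidableEq K] [Fintype K]

lemma expect_pairings_equiv (e : H ≃ K) (φ : Finset (Sym2 K) → ℝ) :
    (pairings K (Fintype.card K % 2)).expect φ =
      (pairings H (Fintype.card H % 2)).expect fun m => φ (mapPairs e m) := by
  symm
  refine expect_nbij' (mapPairs e) (mapPairs e.symm) ?_ ?_ ?_ ?_ fun _ _ => rfl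
  · intro m hm
    rw [mem_pairings_mod] at hm ⊢
    rw [card_mapPairs e.injective, ← Fintype.card_congr e]
    exact ⟨hm.1.mapPairs e.injective, hm.2⟩
  · intro m hm
    rw [mem_pairings_mod] at hm ⊢
    rw [card_mapPairs e.symm.injective, Fintype.card_congr e]
    exact ⟨hm.1.mapPairs e.symm.injective, hm.2⟩
  · intro m _
    rw [mapPairs_mapPairs]
    simp [mapPairs_id]
  · intro m _
    rw [mapPairs_mapPairs]
    simp [mapPairs_id]

lemma avgMaxCut_image_equiv (e : H ≃ K) (T : Finset (K → Bool)) :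
    avgMaxCut (T.image fun τ => τ ∘ e) = avgMaxCut T := by
  unfold avgMaxCut
  rw [expect_pairings_equiv e]
  simp only [maxCut_mapPairs e.injective]

end Relabel

/-! ### Balanced colourings. -/

section Bisections

variable {V W : Type*} [DecidableEq V] [Fintype V] [DecidableEq W] [Fintype W]

/-- The balanced two-colourings of `V`. -/
def bisections (V : Type*) [DecidableEq V] [Fintype V] : Finset (V → Bool) :=
  {σ | |(#{v | σ v = true} : ℤ) - #{v | σ v = false}| ≤ 1}

lemma mem_bisections {σ : V → Bool} :
    σ ∈ bisections V ↔ |(#{v | σ v = true} : ℤ) - #{v | σ v = false}| ≤ 1 := by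
  simp [bisections]

lemma card_true_add_card_false (σ : V → Bool) :
    #{v | σ v = true} + #{v | σ v = false} = Fintype.card V := by
  rw [← card_univ, ← card_filter_add_card_filter_not (s := univ) (fun v => σ v = true)]
  simp

lemma bisections_nonempty (V : Type*) [DecidableEq V] [Fintype V] : (bisections V).Nonempty := by
  obtain ⟨s, -, hs⟩ := exists_subset_card_eq (s := (univ : Finset V)) (n := Fintype.card V / 2)
    (by rw [card_univ]; omega)
  refine ⟨fun v => decide (v ∈ s), ?_⟩
  rw [mem_bisections]
  have h := card_true_add_card_false (fun v => decide (v ∈ s))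
  have h' : #{v | decide (v ∈ s) = true} = Fintype.card V / 2 := by
    rw [← hs]
    congr 1
    ext
    simp
  rw [abs_le]
  omega

lemma comp_mem_bisections (e : W ≃ V) {σ : V → Bool} (h : σ ∈ bisections V) :
    σ ∘ e ∈ bisections W := by
  rw [mem_bisections] at h ⊢
  have : ∀ b : Bool, #{w | (σ ∘ e) w = b} = #{v | σ v = b} := fun b =>
    card_bij (fun w _ => e w) (by simp) (by simp) fun v hv => ⟨e.symm v, by simpa using hv⟩
  rwa [this, this]

/-- Each imbalance lies in {-1, 0, 1}; only equal nonzero signs break the balance of the union, and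
then a reversal makes them cancel. -/
lemma sumElim_mem_bisections {σ : V → Bool} {τ : W → Bool} (hσ : σ ∈ bisections V)
    (hτ : τ ∈ bisections W) :
    Sum.elim σ τ ∈ bisections (V ⊕ W) ∨ Sum.elim σ (fun x => !τ x) ∈ bisections (V ⊕ W) := by
  rw [mem_bisections] at *
  rw [mem_bisections]
  have key : ∀ (σ : V → Bool) (τ : W → Bool) (b : Bool),
      #{x | Sum.elim σ τ x = b} = #{v | σ v = b} + #{w | τ w = b} := by
    intro σ τ b
    simp only [card_filter, Fintype.sum_sum_type, Sum.elim_inl, Sum.elim_inr]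
    rfl
  simp only [key, Bool.not_eq_true', Bool.not_eq_false']
  rw [abs_le] at *
  rw [abs_le]
  push_cast
  omega

end Bisections

/-! ### Dependence of the mean on the degree sequence. -/

section Degrees

variable {V W : Type*} [DecidableEq V] [Fintype V] [DecidableEq W] [Fintype W]

/-- The balanced two-colourings, seen as colourings of the half-edges. -/
def halfEdgeBisections (d : V → ℕ) : Finset ((Σ v, Fin (d v)) → Bool) :=
  (bisections V).image fun σ h => σ h.1

lemma halfEdgeBisections_nonempty (d : V → ℕ) : (halfEdgeBisections d).Nonempty :=
  (bisections_nonempty V).image _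

/-- The mean of the maximum bisection of the random multigraph with degrees `d`. -/
noncomputable def degMaxCut (d : V → ℕ) : ℝ := avgMaxCut (halfEdgeBisections d)

lemma degMaxCut_nonneg (d : V → ℕ) : 0 ≤ degMaxCut d := avgMaxCut_nonneg _

lemma degMaxCut_le (d : V → ℕ) : degMaxCut d ≤ ∑ v, d v := by
  have := avgMaxCut_le (halfEdgeBisections d)
  rwa [Fintype.card_sigma, sum_congr rfl fun v _ => Fintype.card_fin (d v)] at this

lemma degMaxCut_comp (e : W ≃ V) (d : V → ℕ) : degMaxCut (d ∘ e) = degMaxCut d := by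
  unfold degMaxCut
  rw [← avgMaxCut_image_equiv (Equiv.sigmaCongrLeft (β := fun v => Fin (d v)) e)]
  congr 1
  unfold halfEdgeBisections
  rw [image_image]
  ext τ
  simp only [mem_image]
  constructor
  · rintro ⟨σ, hσ, rfl⟩
    refine ⟨σ ∘ e.symm, comp_mem_bisections e.symm hσ, ?_⟩
    ext ⟨w, i⟩
    simp [Equiv.sigmaCongrLeft]
  · rintro ⟨σ, hσ, rfl⟩
    refine ⟨σ ∘ e, comp_mem_bisections e hσ, ?_⟩
    ext ⟨w, i⟩
    simp [Equiv.sigmaCongrLeft]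

lemma abs_degMaxCut_add_sub_le (d k : V → ℕ) :
    |degMaxCut (d + k) - degMaxCut d| ≤ ∑ v, (k v : ℝ) + 1 := by
  let e : ((Σ v, Fin (d v)) ⊕ Σ v, Fin (k v)) ≃ Σ v, Fin ((d + k) v) :=
    (Equiv.sigmaSumDistrib _ _).symm.trans (Equiv.sigmaCongrRight fun v => finSumFinEquiv)
  have h := abs_avgMaxCut_sub_le (T := (halfEdgeBisections (d + k)).image fun τ => τ ∘ e)
    ((halfEdgeBisections_nonempty _).image _)
  rw [avgMaxCut_image_equiv, image_image, Fintype.card_sigma,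
    sum_congr rfl fun v _ => Fintype.card_fin (k v)] at h
  push_cast at h
  have e1 : (halfEdgeBisections (d + k)).image ((fun τ => τ ∘ Sum.inl) ∘ fun τ => τ ∘ e) =
      halfEdgeBisections d := by
    unfold halfEdgeBisections
    rw [image_image]
    rfl
  rwa [e1] at h

lemma degMaxCut_add_le (d₁ : V → ℕ) (d₂ : W → ℕ) {D : ℕ} (hD : 0 < D) :
    degMaxCut d₁ + degMaxCut d₂ ≤ degMaxCut (Sum.elim d₁ d₂) + (2 * D + 1) +
      ((∑ v, d₁ v : ℕ) / (D : ℝ) ^ 2 + 1 / D) * (∑ v, d₁ v : ℕ) := by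
  let e : ((Σ v, Fin (d₁ v)) ⊕ Σ v, Fin (d₂ v)) ≃ Σ v, Fin (Sum.elim d₁ d₂ v) :=
    (Equiv.sumSigmaDistrib fun v => Fin (Sum.elim d₁ d₂ v)).symm
  have h := avgMaxCut_add_le (T₁ := halfEdgeBisections d₁) (T₂ := halfEdgeBisections d₂)
    (T := (halfEdgeBisections (Sum.elim d₁ d₂)).image fun τ => τ ∘ e)
    (halfEdgeBisections_nonempty _) (halfEdgeBisections_nonempty _) ?_ hD
  · rwa [avgMaxCut_image_equiv, Fintype.card_sigma,
      sum_congr rfl fun v _ => Fintype.card_fin (d₁ v)] at h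
  · intro τ₁ hτ₁ τ₂ hτ₂
    obtain ⟨σ₁, h₁, rfl⟩ := mem_image.1 hτ₁
    obtain ⟨σ₂, h₂, rfl⟩ := mem_image.1 hτ₂
    unfold halfEdgeBisections
    rw [image_image]
    refine (sumElim_mem_bisections h₁ h₂).imp (fun h => ?_) (fun h => ?_)
    · refine mem_image.2 ⟨_, h, ?_⟩
      ext (x | x) <;> rfl
    · refine mem_image.2 ⟨_, h, ?_⟩
      ext (x | x) <;> rfl

/-- Both sequences are compared with `f ⊓ g`; each comparison costs an additive 1. -/
lemma abs_degMaxCut_sub_le (f g : V → ℕ) :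
    |degMaxCut f - degMaxCut g| ≤ ∑ v, |(f v : ℝ) - g v| + 2 := by
  have e : ∀ f g : V → ℕ, f = f ⊓ g + (f - f ⊓ g) := fun f g => by
    ext v
    simp only [Pi.add_apply, Pi.inf_apply, Pi.sub_apply]
    omega
  have h1 := abs_degMaxCut_add_sub_le (f ⊓ g) (f - f ⊓ g)
  have h2 := abs_degMaxCut_add_sub_le (g ⊓ f) (g - g ⊓ f)
  rw [← e] at h1 h2
  rw [inf_comm g f] at h2
  have h3 : ∑ v, |(f v : ℝ) - g v| =
      ∑ v, (((f - f ⊓ g) v : ℕ) : ℝ) + ∑ v, (((g - f ⊓ g) v : ℕ) : ℝ) := by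
    rw [← sum_add_distrib]
    refine sum_congr rfl fun v _ => ?_
    simp only [Pi.inf_apply, Pi.sub_apply]
    rcases le_total (f v) (g v) with h | h
    · rw [inf_eq_left.2 h, Nat.sub_self, Nat.cast_sub h, abs_of_nonpos]
      · simp
      · rw [sub_nonpos]
        exact_mod_cast h
    · rw [inf_eq_right.2 h, Nat.sub_self, Nat.cast_sub h, abs_of_nonneg]
      · simp
      · rw [sub_nonneg]
        exact_mod_cast h
  have h4 := abs_sub_le (degMaxCut f) (degMaxCut (f ⊓ g)) (degMaxCut g)
  rw [abs_sub_comm (degMaxCut (f ⊓ g))] at h4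
  linarith

lemma abs_card_sub_card_of_subset_or {α : Type*} [DecidableEq α] [Fintype α] (P Q : α → Prop)
    [DecidablePred P] [DecidablePred Q] (h : (∀ x, P x → Q x) ∨ ∀ x, Q x → P x) :
    ∑ x, |(if P x then (1 : ℝ) else 0) - if Q x then 1 else 0| =
      |(#{x | P x} : ℝ) - #{x | Q x}| := by
  simp only [card_filter, Nat.cast_sum, Nat.cast_ite, Nat.cast_one, Nat.cast_zero]
  rw [← sum_sub_distrib]
  rcases h with h | h
  · rw [abs_of_nonpos, ← sum_neg_distrib]
    · refine sum_congr rfl fun x _ => ?_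
      have := h x
      split_ifs <;> simp_all
    · refine sum_nonpos fun x _ => ?_
      have := h x
      split_ifs <;> simp_all
  · rw [abs_of_nonneg]
    · refine sum_congr rfl fun x _ => ?_
      have := h x
      split_ifs <;> simp_all
    · refine sum_nonneg fun x _ => ?_
      have := h x
      split_ifs <;> simp_all

lemma sum_range_ite_lt {a K : ℕ} (h : a ≤ K) :
    ∑ k ∈ range K, (if k < a then (1 : ℝ) else 0) = a := by
  rw [← sum_filter]
  have : (range K).filter (· < a) = range a := by
    ext k
    simp only [mem_filter, mem_range]
    omega
  simp [this]

lemma abs_sub_le_sum_range {a b K : ℕ} (ha : a ≤ K) (hb : b ≤ K) :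
    |(a : ℝ) - b| ≤
      ∑ k ∈ range K, |(if k < a then (1 : ℝ) else 0) - if k < b then 1 else 0| := by
  rw [← sum_range_ite_lt ha, ← sum_range_ite_lt hb, ← sum_sub_distrib]
  exact abs_sum_le_sum_abs _ _

/-- After sorting both sequences their superlevel sets are nested, so the ℓ¹ distance is bounded by
the sum of the differences of the tail counts. -/
lemma abs_degMaxCut_sub_le_tails {n : ℕ} (f g : Fin n → ℕ) {K : ℕ} (hf : ∀ i, f i ≤ K)
    (hg : ∀ i, g i ≤ K) :
    |degMaxCut f - degMaxCut g| ≤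
      ∑ k ∈ range K, |(#{i | k < f i} : ℝ) - #{i | k < g i}| + 2 := by
  rw [← degMaxCut_comp (Tuple.sort f) f, ← degMaxCut_comp (Tuple.sort g) g]
  refine (abs_degMaxCut_sub_le _ _).trans (add_le_add_left ?_ _)
  have hf' := Tuple.monotone_sort f
  have hg' := Tuple.monotone_sort g
  have e : ∀ (f : Fin n → ℕ) (k : ℕ),
      #{i | k < f i} = #{i | k < (f ∘ Tuple.sort f) i} := fun f k =>
    (card_bij (fun i _ => Tuple.sort f i) (by simp) (by simp)
      fun i hi => ⟨(Tuple.sort f).symm i, by simpa using hi⟩).symm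
  simp only [e f, e g]
  calc ∑ v, |((f ∘ Tuple.sort f) v : ℝ) - (g ∘ Tuple.sort g) v|
      ≤ ∑ v, ∑ k ∈ range K, |(if k < (f ∘ Tuple.sort f) v then (1 : ℝ) else 0) -
          if k < (g ∘ Tuple.sort g) v then 1 else 0| :=
        sum_le_sum fun v _ => abs_sub_le_sum_range (hf _) (hg _)
    _ = ∑ k ∈ range K, ∑ v, |(if k < (f ∘ Tuple.sort f) v then (1 : ℝ) else 0) -
          if k < (g ∘ Tuple.sort g) v then 1 else 0| := sum_comm
    _ ≤ _ := by
        refine le_of_eq (sum_congr rfl fun k _ => abs_card_sub_card_of_subset_or _ _ ?_)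
        by_contra! hcon
        obtain ⟨⟨x, hx, hx'⟩, y, hy, hy'⟩ := hcon
        rcases le_total x y with h | h
        · exact (hx.trans_le (hf' h)).not_ge hy'
        · exact (hy.trans_le (hg' h)).not_ge hx'

lemma mul_degMaxCut_le (d : V → ℕ) {D : ℕ} (hD : 0 < D) (q : ℕ) :
    q * degMaxCut d ≤ degMaxCut (fun x : Fin q × V => d x.2) + q * ((2 * D + 1) +
      ((∑ v, d v : ℕ) / (D : ℝ) ^ 2 + 1 / D) * (∑ v, d v : ℕ)) := by
  induction q with
  | zero => simpa using degMaxCut_nonneg _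
  | succ q ih =>
    let e : Fin (q + 1) × V ≃ V ⊕ Fin q × V :=
      ((finSuccEquiv q).prodCongr (Equiv.refl V)).trans optionProdEquiv
    have h1 : (fun x : Fin (q + 1) × V => d x.2) =
        Sum.elim d (fun x : Fin q × V => d x.2) ∘ e := by
      ext ⟨i, v⟩
      cases i using Fin.cases <;> simp [e]
    rw [h1, degMaxCut_comp]
    have h2 := degMaxCut_add_le d (fun x : Fin q × V => d x.2) hD
    push_cast at *
    linarith

lemma mul_degMaxCut_le_of_tails {n n₀ q r : ℕ} (hn : r + q * n₀ = n) (d : Fin n → ℕ)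
    (d₀ : Fin n₀ → ℕ) {D K : ℕ} (hD : 0 < D) (hd : ∀ i, d i ≤ K) (hd₀ : ∀ i, d₀ i ≤ K) :
    q * degMaxCut d₀ ≤ degMaxCut d + q * ((2 * D + 1) +
      ((∑ v, d₀ v : ℕ) / (D : ℝ) ^ 2 + 1 / D) * (∑ v, d₀ v : ℕ)) +
      ∑ k ∈ range K, |(#{i | k < d i} : ℝ) - q * #{i | k < d₀ i}| + 5 := by
  have h1 := mul_degMaxCut_le d₀ hD q
  -- The `r` padding vertices carry no half-edges, so `D = 1` gives the error 3; the comparison of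
  -- tails adds 2, whence the final 5.
  have h2 := degMaxCut_add_le (fun _ : Fin r => 0) (fun x : Fin q × Fin n₀ => d₀ x.2) one_pos
  have h3 := degMaxCut_nonneg (fun _ : Fin r => 0)
  let e : Fin n ≃ Fin r ⊕ Fin q × Fin n₀ :=
    Fintype.equivOfCardEq (by simp [hn])
  rw [← degMaxCut_comp e] at h2
  have h4 := abs_degMaxCut_sub_le_tails d
    (Sum.elim (fun _ : Fin r => 0) (fun x : Fin q × Fin n₀ => d₀ x.2) ∘ e) (K := K) hd ?_
  · have h5 : ∀ k, #{i | k < (Sum.elim (fun _ : Fin r => 0)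
        (fun x : Fin q × Fin n₀ => d₀ x.2) ∘ e) i} = q * #{i | k < d₀ i} := by
      intro k
      have : #{i | k < (Sum.elim (fun _ : Fin r => 0)
        (fun x : Fin q × Fin n₀ => d₀ x.2) ∘ e) i} = #{i | k < Sum.elim (fun _ : Fin r => 0)
        (fun x : Fin q × Fin n₀ => d₀ x.2) i} :=
        card_bij (fun i _ => e i) (by simp) (by simp) fun v hv => ⟨e.symm v, by simpa using hv⟩
      rw [this]
      simp only [card_filter, Fintype.sum_sum_type, Fintype.sum_prod_type, Sum.elim_inl,
        Sum.elim_inr, Nat.not_lt_zero, if_false, sum_const_zero, zero_add]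
      trans ∑ _x : Fin q, ∑ i, if k < d₀ i then 1 else 0
      · rfl
      · rw [sum_const, card_univ, Fintype.card_fin, smul_eq_mul]
    simp only [h5] at h4
    push_cast at *
    have := abs_le.1 h4
    simp only [sum_const_zero, mul_zero] at h2
    linarith
  · intro i
    rcases h : e i with x | x <;> simp [h, hd₀]

end Degrees

/-! ### Convergence of the normalised means. -/

section Limit

lemma exists_interpolation_error {η : ℝ} (hη : 0 < η) :
    ∃ C : ℝ, 0 ≤ C ∧ ∀ R : ℕ, ∃ D : ℕ, 0 < D ∧
      (2 * (D : ℝ) + 1) + ((R : ℝ) / D ^ 2 + 1 / D) * R ≤ η * R + C := by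
  -- `D` of order `η * R / 2` makes `2 * D + 1` at most `η * R + 5` and keeps `R / D` below `2 / η`.
  refine ⟨5 + (2 / η) ^ 2 + 2 / η, by positivity, fun R => ⟨⌈η / 2 * R⌉₊ + 1, by omega, ?_⟩⟩
  set D := ⌈η / 2 * R⌉₊ + 1 with hD
  have h0 : (0 : ℝ) ≤ η / 2 * R := by positivity
  have h1 : (D : ℝ) ≤ η / 2 * R + 2 := by
    have := (Nat.ceil_lt_add_one h0).le
    push_cast [hD]
    linarith
  have h2 : η / 2 * R ≤ D := by
    have := Nat.le_ceil (η / 2 * R)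
    push_cast [hD]
    linarith
  have hD0 : (0 : ℝ) < D := by exact_mod_cast (by omega : 0 < D)
  have h3 : (R : ℝ) / D ≤ 2 / η := by
    rw [div_le_div_iff₀ hD0 hη]
    linarith
  have h4 : (0 : ℝ) ≤ (R : ℝ) / D := by positivity
  have h5 : ((R : ℝ) / D) ^ 2 ≤ (2 / η) ^ 2 := pow_le_pow_left₀ h4 h3 2
  have e : ((R : ℝ) / D ^ 2 + 1 / D) * R = ((R : ℝ) / D) ^ 2 + (R : ℝ) / D := by
    field_simp
  rw [e]
  linarith

/-- Taking the liminf in n and then the limsup in m gives limsup ≤ liminf, as in Fekete's lemma. -/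
lemma tendsto_of_eventually_ge {a : ℕ → ℝ} {B : ℝ} (hB : ∀ᶠ n in atTop, a n ≤ B)
    (h0 : ∀ n, 0 ≤ a n)
    (h : ∀ ε > 0, ∀ᶠ m in atTop, ∀ᶠ n in atTop, a m - ε ≤ a n) :
    ∃ L, Tendsto a atTop (𝓝 L) := by
  have b1 : IsBoundedUnder (· ≤ ·) atTop a := ⟨B, hB⟩
  have b2 : IsBoundedUnder (· ≥ ·) atTop a := ⟨0, eventually_map.2 (Eventually.of_forall h0)⟩
  refine ⟨liminf a atTop, tendsto_of_le_liminf_of_limsup_le le_rfl ?_ b1 b2⟩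
  refine le_of_forall_pos_le_add fun ε hε => ?_
  refine limsup_le_of_le b2.isCoboundedUnder_le ?_
  filter_upwards [h ε hε] with m hm
  have := le_liminf_of_le b1.isCoboundedUnder_ge hm
  linarith

/-- Scheffé's argument: pointwise convergence handles finitely many terms, and convergence of the
total mass leaves little for the rest. The uniformity in `K` is needed because the largest degree
may grow with n. -/
lemma eventually_sum_abs_sub_le {t : ℕ → ℕ → ℝ} {τ : ℕ → ℝ} {ν : ℕ → ℝ} {ν₀ : ℝ}
    (hτ0 : ∀ k, 0 ≤ τ k) (hτ : Tendsto (fun K => ∑ k ∈ range K, τ k) atTop (𝓝 ν₀))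
    (ht0 : ∀ n k, 0 ≤ t n k) (ht : ∀ k, Tendsto (fun n => t n k) atTop (𝓝 (τ k)))
    (hν : ∀ n K, ∑ k ∈ range K, t n k ≤ ν n) (hν₀ : Tendsto ν atTop (𝓝 ν₀))
    {η : ℝ} (hη : 0 < η) :
    ∀ᶠ n in atTop, ∀ K, ∑ k ∈ range K, |t n k - τ k| ≤ η := by
  have hη' : 0 < η / 5 := by positivity
  have hmono : Monotone fun K => ∑ k ∈ range K, τ k := fun K L h =>
    sum_le_sum_of_subset_of_nonneg (range_mono h) fun k _ _ => hτ0 k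
  have hle : ∀ K, ∑ k ∈ range K, τ k ≤ ν₀ := fun K => hmono.ge_of_tendsto hτ K
  obtain ⟨M, hM⟩ := (hτ.eventually (lt_mem_nhds (show ν₀ - η / 5 < ν₀ by linarith))).exists
  have h1 : Tendsto (fun n => ∑ k ∈ range M, |t n k - τ k|) atTop (𝓝 0) := by
    have : Tendsto (fun n => ∑ k ∈ range M, |t n k - τ k|) atTop
        (𝓝 (∑ k ∈ range M, |τ k - τ k|)) :=
      tendsto_finsetSum _ fun k _ => ((ht k).sub_const _).abs
    simpa using this
  filter_upwards [h1.eventually (gt_mem_nhds hη'),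
    hν₀.eventually (gt_mem_nhds (show ν₀ < ν₀ + η / 5 by linarith))] with n hn hn' K
  have hK : ∑ k ∈ range K, |t n k - τ k| ≤ ∑ k ∈ range (M + K), |t n k - τ k| :=
    sum_le_sum_of_subset_of_nonneg (range_mono (by omega)) fun k _ _ => abs_nonneg _
  refine hK.trans ?_
  rw [sum_range_add]
  have h2 : ∑ k ∈ range K, |t n (M + k) - τ (M + k)| ≤
      ∑ k ∈ range K, t n (M + k) + ∑ k ∈ range K, τ (M + k) := by
    rw [← sum_add_distrib]
    refine sum_le_sum fun k _ => ?_
    have a := ht0 n (M + k)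
    have b := hτ0 (M + k)
    rw [abs_le]
    constructor <;> linarith
  have h3 := hν n (M + K)
  have h4 := hle (M + K)
  rw [sum_range_add] at h3 h4
  have h5 : ∑ k ∈ range M, τ k - ∑ k ∈ range M, t n k ≤ ∑ k ∈ range M, |t n k - τ k| := by
    rw [← sum_sub_distrib]
    refine sum_le_sum fun k _ => ?_
    rw [abs_sub_comm]
    exact le_abs_self _
  linarith

lemma tendsto_sum_real_Ioi (μ : Measure ℕ) [IsProbabilityMeasure μ]
    (hμ : Integrable (fun k : ℕ => (k : ℝ)) μ) :
    Tendsto (fun K => ∑ k ∈ range K, μ.real (Set.Ioi k)) atTop (𝓝 (∫ k, (k : ℝ) ∂μ)) := by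
  have e : ∀ K, ∑ k ∈ range K, μ.real (Set.Ioi k) =
      ∫ x, ∑ k ∈ range K, (Set.Ioi k).indicator (fun _ => (1 : ℝ)) x ∂μ := by
    intro K
    rw [integral_finsetSum]
    · refine sum_congr rfl fun k _ => ?_
      rw [integral_indicator_const _ (MeasurableSet.of_discrete)]
      simp
    · intro k _
      exact (integrable_const _).indicator MeasurableSet.of_discrete
  have e2 : ∀ (K x : ℕ), ∑ k ∈ range K, (Set.Ioi k).indicator (fun _ => (1 : ℝ)) x =
      (min x K : ℕ) := by
    intro K x
    simp only [Set.indicator_apply, Set.mem_Ioi]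
    rw [← sum_filter]
    have : (range K).filter (· < x) = range (min x K) := by
      ext k
      simp only [mem_filter, mem_range]
      omega
    simp [this]
  simp only [e, e2]
  refine tendsto_integral_of_dominated_convergence (fun k : ℕ => (k : ℝ)) ?_ hμ ?_ ?_
  · exact fun K => (measurable_of_countable _).aestronglyMeasurable
  · intro K
    refine Eventually.of_forall fun x => ?_
    simp only [Real.norm_eq_abs, Nat.abs_cast]
    exact_mod_cast min_le_left x K
  · refine Eventually.of_forall fun x => ?_
    refine tendsto_const_nhds.congr' ?_
    filter_upwards [eventually_ge_atTop x] with K hK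
    rw [min_eq_left hK]

lemma tendsto_tails {μ : Measure ℕ} [IsProbabilityMeasure μ] {d : (n : ℕ) → Fin n → ℕ}
    (hd : ConvergesInDistribution d μ) (k : ℕ) :
    Tendsto (fun n : ℕ => (#{i | k < d n i} : ℝ) / n) atTop (𝓝 (μ.real (Set.Ioi k))) := by
  have h1 : μ.real (Set.Ioi k) = 1 - ∑ j ∈ range (k + 1), μ.real {j} := by
    rw [← measureReal_biUnion_finset]
    · rw [← probReal_compl_eq_one_sub MeasurableSet.of_discrete]
      congr 1
      ext x
      simp only [Set.mem_Ioi, Set.mem_compl_iff, Set.mem_iUnion, mem_range, Set.mem_singleton_iff,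
        exists_prop, not_exists, not_and]
      exact ⟨fun h i hi => by omega, fun h => by_contra fun h' => h x (by omega) rfl⟩
    · intro i _ j _ hij
      simpa using hij
    · exact fun _ _ => MeasurableSet.of_discrete
  rw [h1]
  have h2 : Tendsto (fun n : ℕ => 1 - ∑ j ∈ range (k + 1),
      (1 / (n : ℝ)) * ∑ i : Fin n, if d n i = j then (1 : ℝ) else 0) atTop
      (𝓝 (1 - ∑ j ∈ range (k + 1), μ.real {j})) :=
    tendsto_const_nhds.sub (tendsto_finsetSum _ fun j _ => hd.1 j)
  refine h2.congr' ?_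
  filter_upwards [eventually_gt_atTop 0] with n hn
  have hn' : (0 : ℝ) < n := by exact_mod_cast hn
  rw [← mul_sum, sum_comm]
  have e : ∀ i : Fin n, ∑ j ∈ range (k + 1), (if d n i = j then (1 : ℝ) else 0) =
      1 - if k < d n i then 1 else 0 := by
    intro i
    rw [sum_ite_eq]
    simp only [mem_range]
    split_ifs <;> first | omega | simp
  rw [sum_congr rfl fun i _ => e i, sum_sub_distrib, sum_boole]
  simp only [sum_const, card_univ, Fintype.card_fin, nsmul_eq_mul, mul_one]
  field_simp
  ring

lemma sum_tails_le {n : ℕ} (d : Fin n → ℕ) (K : ℕ) :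
    ∑ k ∈ range K, (#{i | k < d i} : ℝ) / n ≤ (1 / (n : ℝ)) * ∑ i, (d i : ℝ) := by
  rw [← sum_div, div_eq_inv_mul, one_div]
  refine mul_le_mul_of_nonneg_left ?_ (by positivity)
  simp only [card_filter, Nat.cast_sum, Nat.cast_ite, Nat.cast_one, Nat.cast_zero]
  rw [sum_comm]
  refine sum_le_sum fun i _ => ?_
  rw [← sum_filter, sum_const, nsmul_eq_mul, mul_one]
  have : (range K).filter (· < d i) ⊆ range (d i) := fun k hk => by
    simpa using (mem_filter.1 hk).2
  simpa using card_le_card this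

theorem exists_tendsto_degMaxCut {μ : Measure ℕ} [IsProbabilityMeasure μ]
    (hμ : Integrable (fun k : ℕ => (k : ℝ)) μ) {d : (n : ℕ) → Fin n → ℕ}
    (hd : ConvergesInDistribution d μ) :
    ∃ L, Tendsto (fun n : ℕ => degMaxCut (d n) / n) atTop (𝓝 L) := by
  set ν := ∫ k, (k : ℝ) ∂μ with hν
  have hν0 : 0 ≤ ν := integral_nonneg fun k => Nat.cast_nonneg k
  set τ : ℕ → ℝ := fun k => μ.real (Set.Ioi k) with hτ
  have hτs := tendsto_sum_real_Ioi μ hμ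
  have hτ0 : ∀ k, 0 ≤ τ k := fun k => measureReal_nonneg
  have hτle : ∀ K, ∑ k ∈ range K, τ k ≤ ν := fun K => Monotone.ge_of_tendsto
    (fun K L h => sum_le_sum_of_subset_of_nonneg (range_mono h) fun k _ _ => hτ0 k) hτs K
  have hmean : ∀ᶠ n : ℕ in atTop, ((∑ i, d n i : ℕ) : ℝ) ≤ (ν + 1) * n := by
    filter_upwards [hd.2.eventually (gt_mem_nhds (show ν < ν + 1 by linarith)),
      eventually_gt_atTop 0] with n hn hn0
    have hn' : (0 : ℝ) < n := by exact_mod_cast hn0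
    rw [one_div, ← div_eq_inv_mul, div_lt_iff₀ hn'] at hn
    push_cast
    exact hn.le
  have hbd : ∀ᶠ n : ℕ in atTop, degMaxCut (d n) / n ≤ ν + 1 := by
    filter_upwards [hmean, eventually_gt_atTop 0] with n hn hn0
    have hn' : (0 : ℝ) < n := by exact_mod_cast hn0
    rw [div_le_iff₀ hn']
    have := degMaxCut_le (d n)
    exact this.trans (by exact_mod_cast hn)
  refine tendsto_of_eventually_ge hbd (fun n => div_nonneg (degMaxCut_nonneg _) (by positivity)) ?_
  intro ε hε
  -- The budget per vertex: `η * (ν + 2)` for the interpolation, `2 * η` for the tails, `η` for the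
  -- terms that vanish as n grows with m fixed.
  obtain ⟨η, hη, hηε⟩ : ∃ η > 0, η * (ν + 5) ≤ ε :=
    ⟨ε / (ν + 5), by positivity, by rw [div_mul_cancel₀]; positivity⟩
  obtain ⟨C, hC, hD⟩ := exists_interpolation_error hη
  have hW := eventually_sum_abs_sub_le hτ0 hτs
    (t := fun n k => (#{i | k < d n i} : ℝ) / n) (fun n k => by positivity)
    (tendsto_tails hd) (fun n K => sum_tails_le (d n) K) hd.2 hη
  have hCm : ∀ᶠ m : ℕ in atTop, C / m ≤ η :=
    (tendsto_const_div_atTop_nhds_zero_nat C).eventually (ge_mem_nhds hη)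
  filter_upwards [hmean, hbd, hW, hCm, eventually_gt_atTop 0] with m hm hmb hmW hmC hm0
  have hsmall : ∀ᶠ n : ℕ in atTop, (m * (2 * ν + 1) + 5) / (n : ℝ) ≤ η :=
    (tendsto_const_div_atTop_nhds_zero_nat _).eventually (ge_mem_nhds hη)
  filter_upwards [hW, hsmall, eventually_gt_atTop 0] with n hnW hns hn0
  obtain ⟨D, hD0, hDle⟩ := hD (∑ i, d m i)
  set K := ∑ i, d n i + ∑ i, d m i with hK
  have hn' : (0 : ℝ) < n := by exact_mod_cast hn0
  have hm' : (0 : ℝ) < m := by exact_mod_cast hm0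
  have key := mul_degMaxCut_le_of_tails (q := n / m) (r := n % m)
    (by rw [mul_comm]; exact Nat.mod_add_div n m) (d n) (d m) hD0 (K := K)
    (fun i => (single_le_sum (f := d n) (fun _ _ => Nat.zero_le _) (mem_univ i)).trans
      (Nat.le_add_right _ _))
    (fun i => (single_le_sum (f := d m) (fun _ _ => Nat.zero_le _) (mem_univ i)).trans
      (Nat.le_add_left _ _))
  set q : ℝ := ((n / m : ℕ) : ℝ) with hq
  have hq0 : 0 ≤ q := Nat.cast_nonneg _
  have hqm : q * m ≤ n := by
    rw [hq]
    exact_mod_cast Nat.div_mul_le_self n m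
  have hqm' : (n : ℝ) ≤ q * m + m := by
    rw [hq]
    have := Nat.mod_add_div n m
    have h2 := (Nat.mod_lt n hm0).le
    have : n ≤ n / m * m + m := by
      rw [mul_comm (n / m) m]
      omega
    exact_mod_cast this
  have tails : ∑ k ∈ range K, |(#{i | k < d n i} : ℝ) - q * #{i | k < d m i}| ≤
      n * η + n * η + m * ν := by
    have : ∀ k, |(#{i | k < d n i} : ℝ) - q * #{i | k < d m i}| ≤
        n * |(#{i | k < d n i} : ℝ) / n - τ k| + n * |(#{i | k < d m i} : ℝ) / m - τ k|
          + m * τ k := by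
      intro k
      -- Both normalised tail counts are measured against the limit `τ k`; the last term accounts
      -- for the fewer than `m` vertices left over by the division.
      have e : (#{i | k < d n i} : ℝ) - q * #{i | k < d m i} =
          n * ((#{i | k < d n i} : ℝ) / n - τ k) - (q * m) * ((#{i | k < d m i} : ℝ) / m - τ k)
            + (n - q * m) * τ k := by
        field_simp
        ring
      rw [e]
      refine (abs_add_le _ _).trans (add_le_add ((abs_sub _ _).trans (add_le_add ?_ ?_)) ?_)
      · rw [abs_mul, abs_of_pos hn']
      · rw [abs_mul, abs_of_nonneg (by positivity : (0 : ℝ) ≤ q * m)]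
        exact mul_le_mul_of_nonneg_right hqm (abs_nonneg _)
      · rw [abs_mul, abs_of_nonneg (hτ0 k), abs_of_nonneg (by linarith)]
        exact mul_le_mul_of_nonneg_right (by linarith) (hτ0 k)
    refine (sum_le_sum fun k _ => this k).trans ?_
    rw [sum_add_distrib, sum_add_distrib, ← mul_sum, ← mul_sum, ← mul_sum]
    exact add_le_add (add_le_add (mul_le_mul_of_nonneg_left (hnW K) hn'.le)
      (mul_le_mul_of_nonneg_left (hmW K) hn'.le)) (mul_le_mul_of_nonneg_left (hτle K) hm'.le)
  have herr : q * ((2 * (D : ℝ) + 1) + ((∑ v, d m v : ℕ) / (D : ℝ) ^ 2 + 1 / D) *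
      (∑ v, d m v : ℕ)) ≤ n * (η * (ν + 2)) := by
    have h1 : η * ((∑ v, d m v : ℕ) : ℝ) + C ≤ m * (η * (ν + 2)) := by
      rw [div_le_iff₀ hm'] at hmC
      nlinarith
    calc _ ≤ q * (m * (η * (ν + 2))) :=
          mul_le_mul_of_nonneg_left (hDle.trans h1) hq0
      _ = (q * m) * (η * (ν + 2)) := by ring
      _ ≤ _ := mul_le_mul_of_nonneg_right hqm (by positivity)
  have hlow : (degMaxCut (d m) / m) * n - m * (ν + 1) ≤ q * degMaxCut (d m) := by
    have e : q * degMaxCut (d m) = (q * m) * (degMaxCut (d m) / m) := by field_simp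
    rw [e]
    have h0 : 0 ≤ degMaxCut (d m) / m := div_nonneg (degMaxCut_nonneg _) hm'.le
    nlinarith
  rw [div_le_iff₀ hn'] at hns
  rw [le_div_iff₀ hn']
  have : η * (ν + 5) * n ≤ ε * n := mul_le_mul_of_nonneg_right hηε hn'.le
  linarith

end Limit

/-! ### Concentration for functions of a uniform permutation. -/

section Permutations

open Equiv

lemma exp_le_add_exp_sq (x : ℝ) : Real.exp x ≤ x + Real.exp (x ^ 2) := by
  have h2 := Real.add_one_le_exp (x ^ 2)
  rcases le_total |x| 1 with h | h
  · have h1 := le_of_abs_le (Real.abs_exp_sub_one_sub_id_le h)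
    linarith
  · rcases le_abs.1 h with h' | h'
    · have : Real.exp x ≤ Real.exp (x ^ 2) := Real.exp_le_exp.2 (by nlinarith)
      linarith
    · have : Real.exp x ≤ 1 := Real.exp_le_one_iff.2 (by linarith)
      nlinarith

/-- In `exp x ≤ x + exp (x ^ 2)` the linear term has mean zero after centring, which leaves a
sub-Gaussian bound. -/
lemma expect_exp_le {ι : Type*} [Fintype ι] [Nonempty ι] (x : ι → ℝ) {c : ℝ}
    (h : ∀ i j, |x i - x j| ≤ c) (t : ℝ) :
    univ.expect (fun i => Real.exp (t * (x i - univ.expect x))) ≤ Real.exp (c ^ 2 * t ^ 2) := by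
  have h1 : ∀ i, |x i - univ.expect x| ≤ c := by
    intro i
    rw [← expect_const (univ_nonempty (α := ι)) (x i), ← expect_sub_distrib]
    exact (abs_expect_le _ _).trans (expect_le univ_nonempty fun j _ => h i j)
  calc univ.expect (fun i => Real.exp (t * (x i - univ.expect x)))
      ≤ univ.expect (fun i => t * (x i - univ.expect x) + Real.exp (c ^ 2 * t ^ 2)) := by
        refine expect_le_expect fun i _ => (exp_le_add_exp_sq _).trans ?_
        have : (t * (x i - univ.expect x)) ^ 2 ≤ c ^ 2 * t ^ 2 := by
          rw [mul_pow, mul_comm, ← sq_abs (x i - _)]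
          exact mul_le_mul_of_nonneg_right (pow_le_pow_left₀ (abs_nonneg _) (h1 i) 2)
            (sq_nonneg t)
        linarith [Real.exp_le_exp.2 this]
    _ = Real.exp (c ^ 2 * t ^ 2) := by
        rw [expect_add_distrib, expect_const univ_nonempty, ← mul_expect, expect_sub_distrib,
          expect_const univ_nonempty, sub_self, mul_zero, zero_add]

lemma decomposeFin_symm_eq_swap_mul {n : ℕ} (p : Fin (n + 1)) (e : Perm (Fin n)) :
    Perm.decomposeFin.symm (p, e) = swap 0 p * Perm.decomposeFin.symm (0, e) := by
  ext x
  cases x using Fin.cases with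
  | zero => simp
  | succ x =>
    rw [Perm.decomposeFin_symm_apply_succ, Perm.mul_apply, Perm.decomposeFin_symm_apply_succ]
    simp

lemma decomposeFin_symm_swap_mul {n : ℕ} (p : Fin (n + 1)) (a b : Fin n) (e : Perm (Fin n)) :
    Perm.decomposeFin.symm (p, swap a b * e) =
      swap (swap 0 p a.succ) (swap 0 p b.succ) * Perm.decomposeFin.symm (p, e) := by
  have h : Perm.decomposeFin.symm (0, swap a b * e) =
      swap a.succ b.succ * Perm.decomposeFin.symm (0, e) := by
    ext x
    cases x using Fin.cases with
    | zero =>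
      rw [Perm.decomposeFin_symm_apply_zero, Perm.mul_apply, Perm.decomposeFin_symm_apply_zero,
        swap_apply_of_ne_of_ne (Fin.succ_ne_zero a).symm (Fin.succ_ne_zero b).symm]
    | succ x =>
      rw [Perm.mul_apply, Perm.decomposeFin_symm_apply_succ, Perm.decomposeFin_symm_apply_succ]
      simp only [swap_self, refl_apply, Perm.mul_apply]
      rw [(Fin.succ_injective n).swap_apply]
  rw [decomposeFin_symm_eq_swap_mul, h, decomposeFin_symm_eq_swap_mul p e, ← mul_assoc,
    ← mul_assoc]
  congr 1
  exact mul_swap_eq_swap_mul _ _ _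

/-- Condition on the image of 0. The conditional means differ from that at 0 by at most `c`, since
`swap 0 p` maps one fibre onto the other, hence from one another by `2 * c`. Within a fibre the
function is again `c`-Lipschitz under transpositions, so each level contributes `(2 * c) ^ 2 * t ^
2` to the exponent. -/
lemma expect_exp_perm_fin_le {N : ℕ} (f : Perm (Fin N) → ℝ) {c : ℝ}
    (hf : ∀ a b π, |f (swap a b * π) - f π| ≤ c) (t : ℝ) :
    univ.expect (fun π => Real.exp (t * (f π - univ.expect f))) ≤
      Real.exp (4 * c ^ 2 * t ^ 2 * N) := by
  induction N with
  | zero =>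
    simp
  | succ N ih =>
    set D : Fin (N + 1) → Perm (Fin N) → Perm (Fin (N + 1)) :=
      fun p e => Perm.decomposeFin.symm (p, e) with hD
    have hE : ∀ g : Perm (Fin (N + 1)) → ℝ,
        univ.expect g = univ.expect fun p => univ.expect fun e => g (D p e) := by
      intro g
      rw [← expect_product', univ_product_univ]
      exact (Fintype.expect_equiv Perm.decomposeFin.symm _ _ fun _ => rfl).symm
    set x : Fin (N + 1) → ℝ := fun p => univ.expect fun e => f (D p e) with hx
    have hx0 : ∀ p, |x p - x 0| ≤ c := by
      intro p
      rw [hx, ← expect_sub_distrib]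
      refine (abs_expect_le _ _).trans (expect_le univ_nonempty fun e _ => ?_)
      have := hf 0 p (D 0 e)
      rwa [hD, ← decomposeFin_symm_eq_swap_mul] at this
    have hxx : ∀ p p', |x p - x p'| ≤ 2 * c := by
      intro p p'
      have h1 := hx0 p
      have h2 := hx0 p'
      rw [abs_le] at *
      constructor <;> linarith
    have hfx : univ.expect f = univ.expect x := hE f
    calc univ.expect (fun π => Real.exp (t * (f π - univ.expect f)))
        = univ.expect fun p => Real.exp (t * (x p - univ.expect x)) *
            univ.expect fun e => Real.exp (t * (f (D p e) - x p)) := by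
          rw [hE, hfx]
          refine expect_congr rfl fun p _ => ?_
          rw [mul_expect]
          refine expect_congr rfl fun e _ => ?_
          rw [← Real.exp_add]
          ring_nf
      _ ≤ univ.expect fun p => Real.exp (t * (x p - univ.expect x)) *
            Real.exp (4 * c ^ 2 * t ^ 2 * N) := by
          refine expect_le_expect fun p _ => mul_le_mul_of_nonneg_left ?_ (Real.exp_pos _).le
          refine ih (fun e => f (D p e)) fun a b e => ?_
          simp only [hD]
          rw [decomposeFin_symm_swap_mul]
          exact hf _ _ _
      _ = (univ.expect fun p => Real.exp (t * (x p - univ.expect x))) *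
            Real.exp (4 * c ^ 2 * t ^ 2 * N) := by rw [expect_mul]
      _ ≤ Real.exp ((2 * c) ^ 2 * t ^ 2) * Real.exp (4 * c ^ 2 * t ^ 2 * N) :=
          mul_le_mul_of_nonneg_right (expect_exp_le x hxx t) (Real.exp_pos _).le
      _ = _ := by
          rw [← Real.exp_add]
          congr 1
          push_cast
          ring

variable {H : Type*} [DecidableEq H] [Fintype H]

lemma expect_exp_perm_le (f : Perm H → ℝ) {c : ℝ}
    (hf : ∀ a b π, |f (swap a b * π) - f π| ≤ c) (t : ℝ) :
    univ.expect (fun π => Real.exp (t * (f π - univ.expect f))) ≤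
      Real.exp (4 * c ^ 2 * t ^ 2 * Fintype.card H) := by
  let e := (Fintype.equivFin H).symm
  have h := expect_exp_perm_fin_le (fun π => f (e.permCongr π)) (c := c) (fun a b π => ?_) t
  · have e1 : ∀ g : Perm H → ℝ, univ.expect (fun π => g (e.permCongr π)) = univ.expect g :=
      fun g => Fintype.expect_equiv e.permCongr _ _ fun _ => rfl
    rw [e1 f] at h
    rwa [← e1 fun π => Real.exp (t * (f π - univ.expect f))]
  · have : e.permCongr (swap a b * π) = swap (e a) (e b) * e.permCongr π := by
      ext x
      simp only [permCongr_apply, Perm.mul_apply]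
      rw [e.injective.swap_apply]
    rw [this]
    exact hf _ _ _

lemma mem_free_mapPairs (ρ : Perm H) {m : Finset (Sym2 H)} {a : H} :
    ρ a ∈ free (mapPairs ρ m) ↔ a ∈ free m := by
  simp [mem_free, mem_mapPairs]

lemma mapPairs_swap_of_free {m : Finset (Sym2 H)} {a b : H} (ha : a ∈ free m) (hb : b ∈ free m) :
    mapPairs (swap a b) m = m := by
  have : ∀ e ∈ m, e.map (swap a b) = e := by
    intro e he
    rw [mem_free] at ha hb
    have ha := ha e he
    have hb := hb e he
    induction e with | _ x y =>
    simp only [Sym2.mem_iff, not_or] at ha hb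
    rw [Sym2.map_mk]
    rw [swap_apply_of_ne_of_ne (Ne.symm ha.1) (Ne.symm hb.1),
      swap_apply_of_ne_of_ne (Ne.symm ha.2) (Ne.symm hb.2)]
  unfold mapPairs
  rw [image_congr (g := id) this, image_id]

lemma mapPairs_insert (ρ : Perm H) (m : Finset (Sym2 H)) (a b : H) :
    mapPairs ρ (insert s(a, b) m) = insert s(ρ a, ρ b) (mapPairs ρ m) := by
  simp [mapPairs, image_insert]

lemma mapPairs_perm_mul (ρ σ : Perm H) (m : Finset (Sym2 H)) :
    mapPairs (ρ * σ) m = mapPairs ρ (mapPairs σ m) := by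
  rw [mapPairs_mapPairs, Perm.coe_mul]

/-- Permutations act transitively on pairings of a given size: after matching all pairs but one, two
transpositions of free points put the last pair in place without disturbing the others. -/
lemma exists_mapPairs_eq {m m' : Finset (Sym2 H)} (hm : IsPairing m) (hm' : IsPairing m')
    (h : #m = #m') : ∃ ρ : Perm H, mapPairs ρ m = m' := by
  induction m using Finset.induction_on generalizing m' with
  | empty =>
    rw [card_empty] at h
    rw [card_eq_zero.1 h.symm]
    exact ⟨1, by simp [mapPairs]⟩
  | insert e m he ih =>
    rw [card_insert_of_notMem he] at h
    obtain ⟨e', he'⟩ : m'.Nonempty := card_pos.1 (by omega)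
    obtain ⟨ρ, hρ⟩ := ih (hm.subset (subset_insert _ _)) (hm'.subset (erase_subset e' m'))
      (by rw [card_erase_of_mem he']; omega)
    induction e with | _ a b =>
    induction e' with | _ c d =>
    have hab := hm.mem_free_erase (mem_insert_self _ _)
    rw [erase_insert he] at hab
    have hcd := hm'.mem_free_erase he'
    have hne : a ≠ b := hm.ne (mem_insert_self _ _)
    have hne' : c ≠ d := hm'.ne he'
    have ha := (mem_free_mapPairs ρ).2 hab.1
    have hb := (mem_free_mapPairs ρ).2 hab.2
    rw [hρ] at ha hb
    have e1 := mapPairs_swap_of_free ha hcd.1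
    have hb' := (mem_free_mapPairs (swap (ρ a) c)).2 hb
    rw [e1] at hb'
    have e2 := mapPairs_swap_of_free hb' hcd.2
    refine ⟨swap (swap (ρ a) c (ρ b)) d * swap (ρ a) c * ρ, ?_⟩
    rw [mapPairs_perm_mul, mapPairs_perm_mul, mapPairs_insert, hρ, mapPairs_insert, e1,
      mapPairs_insert, e2, swap_apply_left, swap_apply_left, swap_apply_of_ne_of_ne _ hne',
      insert_erase he']
    intro hc
    have : swap (ρ a) c (ρ a) = swap (ρ a) c (ρ b) := by rw [swap_apply_left, ← hc]
    exact hne (ρ.injective ((swap (ρ a) c).injective this))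

/-- No stabiliser is counted: the mean over pairings is invariant under each permutation, and after
exchanging the two averages the inner one does not depend on the pairing, by transitivity. -/
lemma expect_pairings_eq_expect_perm {m₀ : Finset (Sym2 H)}
    (hm₀ : m₀ ∈ pairings H (Fintype.card H % 2)) (φ : Finset (Sym2 H) → ℝ) :
    (pairings H (Fintype.card H % 2)).expect φ =
      univ.expect fun π : Perm H => φ (mapPairs π m₀) := by
  have h1 : ∀ m ∈ pairings H (Fintype.card H % 2),
      univ.expect (fun π : Perm H => φ (mapPairs π m)) =
        univ.expect fun π : Perm H => φ (mapPairs π m₀) := by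
    intro m hm
    rw [mem_pairings_mod] at hm hm₀
    obtain ⟨ρ, rfl⟩ := exists_mapPairs_eq hm₀.1 hm.1 (hm₀.2.trans hm.2.symm)
    exact Fintype.expect_equiv (Equiv.mulRight ρ) _ _ fun π => by
      rw [coe_mulRight, mapPairs_perm_mul]
  calc (pairings H (Fintype.card H % 2)).expect φ
      = univ.expect fun _π : Perm H => (pairings H (Fintype.card H % 2)).expect φ :=
        (expect_const univ_nonempty _).symm
    _ = univ.expect fun π : Perm H =>
          (pairings H (Fintype.card H % 2)).expect fun m => φ (mapPairs π m) :=
        expect_congr rfl fun π _ => expect_pairings_equiv π φ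
    _ = (pairings H (Fintype.card H % 2)).expect fun m =>
          univ.expect fun π : Perm H => φ (mapPairs π m) := expect_comm _ _ _
    _ = (pairings H (Fintype.card H % 2)).expect fun _ =>
          univ.expect fun π : Perm H => φ (mapPairs π m₀) := expect_congr rfl h1
    _ = _ := expect_const (pairings_mod_nonempty H) _

lemma IsPairing.card_filter_mem_le {m : Finset (Sym2 H)} (hm : IsPairing m) (a : H) :
    #{e ∈ m | a ∈ e} ≤ 1 := by
  rw [card_le_one]
  intro e he f hf
  rw [mem_filter] at he hf
  exact hm.2 e he.1 f hf.1 a he.2 hf.2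

/-- Every pair that is new after the transposition contains `a` or `b`, and a pairing has at most
one pair at each. -/
lemma maxCut_swap_le (T : Finset (H → Bool)) {m : Finset (Sym2 H)} (hm : IsPairing m) (a b : H) :
    maxCut T (mapPairs (swap a b) m) ≤ maxCut T m + 2 := by
  refine Finset.sup_le fun τ hτ => ?_
  set m' := mapPairs (swap a b) m
  have hm' : IsPairing m' := hm.mapPairs (swap a b).injective
  have h1 : cut τ m' ≤ cut τ m + #(m' \ m) := by
    unfold cut
    refine le_trans (card_le_card ?_) (card_union_le _ _)
    intro e he
    rw [mem_filter] at he
    rw [mem_union, mem_filter, Finset.mem_sdiff]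
    tauto
  have h2 : m' \ m ⊆ {e ∈ m' | a ∈ e} ∪ {e ∈ m' | b ∈ e} := by
    intro e he
    rw [Finset.mem_sdiff] at he
    rw [mem_union, mem_filter, mem_filter]
    by_contra hcon
    have ha : a ∉ e := fun h => hcon (Or.inl ⟨he.1, h⟩)
    have hb : b ∉ e := fun h => hcon (Or.inr ⟨he.1, h⟩)
    obtain ⟨e', he', rfl⟩ := mem_mapPairs.1 he.1
    apply he.2
    induction e' with | _ x y =>
    simp only [Sym2.map_mk, Sym2.mem_iff, not_or] at ha hb ⊢
    have : ∀ z, a ≠ swap a b z → b ≠ swap a b z → swap a b z = z := by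
      intro z h1 h2
      refine swap_apply_of_ne_of_ne ?_ ?_
      · rintro rfl
        exact h2 (swap_apply_left _ _).symm
      · rintro rfl
        exact h1 (swap_apply_right _ _).symm
    rwa [this x ha.1 hb.1, this y ha.2 hb.2]
  have h3 := (card_le_card h2).trans (card_union_le _ _)
  have h4 := hm'.card_filter_mem_le a
  have h5 := hm'.card_filter_mem_le b
  have h6 := cut_le_maxCut hτ m
  omega

lemma abs_maxCut_swap_sub_le (T : Finset (H → Bool)) {m : Finset (Sym2 H)} (hm : IsPairing m)
    (a b : H) : |(maxCut T (mapPairs (swap a b) m) : ℝ) - maxCut T m| ≤ 2 := by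
  have h1 := maxCut_swap_le T hm a b
  have h2 := maxCut_swap_le T (hm.mapPairs (swap a b).injective) a b
  rw [← mapPairs_perm_mul, swap_mul_self] at h2
  have e : mapPairs (1 : Perm H) m = m := by simp [mapPairs]
  rw [e] at h2
  have h1' : (maxCut T (mapPairs (swap a b) m) : ℝ) ≤ maxCut T m + 2 := by exact_mod_cast h1
  have h2' : (maxCut T m : ℝ) ≤ maxCut T (mapPairs (swap a b) m) + 2 := by exact_mod_cast h2
  rw [abs_le]
  constructor <;> linarith

lemma expect_exp_maxCut_le (T : Finset (H → Bool)) (t : ℝ) :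
    (pairings H (Fintype.card H % 2)).expect
      (fun m => Real.exp (t * ((maxCut T m : ℝ) - avgMaxCut T))) ≤
      Real.exp (16 * t ^ 2 * Fintype.card H) := by
  obtain ⟨m₀, hm₀⟩ := pairings_mod_nonempty H
  have h := expect_exp_perm_le (fun π : Perm H => (maxCut T (mapPairs π m₀) : ℝ)) (c := 2)
    (fun a b π => by
      rw [mapPairs_perm_mul]
      exact abs_maxCut_swap_sub_le T ((mem_pairings.1 hm₀).1.mapPairs π.injective) a b) t
  rw [expect_pairings_eq_expect_perm hm₀]
  unfold avgMaxCut
  rw [expect_pairings_eq_expect_perm hm₀]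
  refine h.trans (le_of_eq ?_)
  norm_num

end Permutations

/-! ### Translation to the random multigraph. -/

section UniformMatching

variable {n : ℕ}

lemma isMatching_iff {d : Fin n → ℕ} {m : Finset (Sym2 (HalfEdge d))} :
    IsMatching m ↔ IsPairing m := Iff.rfl

lemma card_halfEdge (d : Fin n → ℕ) : Fintype.card (HalfEdge d) = ∑ i, d i := by
  rw [Fintype.card_sigma, sum_congr rfl fun v _ => Fintype.card_fin (d v)]

instance (d : Fin n → ℕ) : DiscreteMeasurableSpace (CompleteMatching d) := ⟨fun _ => trivial⟩

instance (d : Fin n → ℕ) : Finite (CompleteMatching d) := by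
  unfold CompleteMatching
  infer_instance

lemma mem_pairings_iff_complete {d : Fin n → ℕ} {m : Finset (Sym2 (HalfEdge d))} :
    m ∈ pairings (HalfEdge d) (Fintype.card (HalfEdge d) % 2) ↔
      IsMatching m ∧ m.card = (∑ i, d i) / 2 := by
  rw [mem_pairings_mod, card_halfEdge, isMatching_iff]

instance (d : Fin n → ℕ) : Nonempty (CompleteMatching d) := by
  obtain ⟨m, hm⟩ := pairings_mod_nonempty (HalfEdge d)
  exact ⟨⟨m, mem_pairings_iff_complete.1 hm⟩⟩

instance (d : Fin n → ℕ) : IsProbabilityMeasure (uniformMatching d) :=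
  isProbabilityMeasure_uniformOn Set.finite_univ Set.univ_nonempty

lemma sum_completeMatching {d : Fin n → ℕ}
    [Fintype (CompleteMatching d)] (g : Finset (Sym2 (HalfEdge d)) → ℝ) :
    ∑ x : CompleteMatching d, g x.1 =
      ∑ m ∈ pairings (HalfEdge d) (Fintype.card (HalfEdge d) % 2), g m :=
  sum_bij (fun x _ => x.1) (fun x _ => mem_pairings_iff_complete.2 x.2)
    (fun _ _ _ _ h => Subtype.ext h)
    (fun m hm => ⟨⟨m, mem_pairings_iff_complete.1 hm⟩, mem_univ _, rfl⟩) fun _ _ => rfl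

lemma integral_uniformMatching (d : Fin n → ℕ) (g : Finset (Sym2 (HalfEdge d)) → ℝ) :
    ∫ x, g x.1 ∂(uniformMatching d) =
      (pairings (HalfEdge d) (Fintype.card (HalfEdge d) % 2)).expect g := by
  have : Fintype (CompleteMatching d) := Fintype.ofFinite _
  rw [integral_fintype (Integrable.of_finite), expect_eq_sum_div_card]
  have h1 : ∀ x : CompleteMatching d, (uniformMatching d).real {x} =
      1 / (Fintype.card (CompleteMatching d) : ℝ) := by
    intro x
    rw [measureReal_def, uniformMatching, uniformOn_univ, Measure.count_singleton]
    simp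
  have h2 : (Fintype.card (CompleteMatching d) : ℝ) =
      #(pairings (HalfEdge d) (Fintype.card (HalfEdge d) % 2)) := by
    have := sum_completeMatching (d := d) fun _ => 1
    simpa using this
  simp only [h1, smul_eq_mul]
  rw [← mul_sum, sum_completeMatching, h2]
  ring

/-- Chernoff's bound for both tails, with `t` left free to be optimised later. -/
lemma measureReal_abs_sub_le (d : Fin n → ℕ) {s t : ℝ} (ht : 0 ≤ t) :
    (uniformMatching d).real {x | s ≤ |(maxCut (halfEdgeBisections d) x.1 : ℝ) - degMaxCut d|} ≤
      2 * Real.exp (16 * t ^ 2 * (∑ i, d i : ℕ) - t * s) := by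
  set X : CompleteMatching d → ℝ :=
    fun x => (maxCut (halfEdgeBisections d) x.1 : ℝ) - degMaxCut d with hX
  have hmgf : ∀ t, mgf X (uniformMatching d) t ≤ Real.exp (16 * t ^ 2 * (∑ i, d i : ℕ)) := by
    intro t
    rw [mgf, hX, integral_uniformMatching d fun m =>
      Real.exp (t * ((maxCut (halfEdgeBisections d) m : ℝ) - degMaxCut d)), ← card_halfEdge]
    exact expect_exp_maxCut_le _ t
  have h1 := measure_ge_le_exp_mul_mgf (μ := uniformMatching d) (X := X) s ht
    Integrable.of_finite
  have h2 := measure_le_le_exp_mul_mgf (μ := uniformMatching d) (X := X) (t := -t) (-s)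
    (by linarith) Integrable.of_finite
  have hsub : {x | s ≤ |X x|} ⊆ {x | s ≤ X x} ∪ {x | X x ≤ -s} := by
    intro x hx
    rcases le_abs.1 (show s ≤ |X x| from hx) with h | h
    · exact Or.inl h
    · exact Or.inr (show X x ≤ -s by linarith)
  have h3 := (measureReal_mono (μ := uniformMatching d) hsub).trans (measureReal_union_le _ _)
  have h4 := mul_le_mul_of_nonneg_left (hmgf t) (Real.exp_pos (-t * s)).le
  have h5 := mul_le_mul_of_nonneg_left (hmgf (-t)) (Real.exp_pos (- -t * -s)).le
  rw [← Real.exp_add] at h4 h5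
  have e1 : -t * s + 16 * t ^ 2 * ((∑ i, d i : ℕ) : ℝ) =
    16 * t ^ 2 * (∑ i, d i : ℕ) - t * s := by ring
  have e2 : - -t * -s + 16 * (-t) ^ 2 * ((∑ i, d i : ℕ) : ℝ) =
    16 * t ^ 2 * (∑ i, d i : ℕ) - t * s := by ring
  rw [e1] at h4
  rw [e2] at h5
  linarith

lemma edgesBetween_inducedGraph {d : Fin n → ℕ} (m : Finset (Sym2 (HalfEdge d)))
    (σ : Fin n → Bool) :
    edgesBetween (inducedGraph m) {v | σ v = true} {v | σ v = false} =
      cut (fun h => σ h.1) m := by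
  unfold edgesBetween cut
  rw [← Set.ncard_coe_finset]
  congr 1
  ext e
  simp only [Set.mem_ofPred_eq, inducedGraph, coe_filter]
  induction e with | _ a b =>
  simp only [Sym2.map_mk, Sym2.mk_isDiag_iff]
  constructor
  · rintro ⟨x, hx, y, hy, hm, h⟩
    refine ⟨hm, ?_⟩
    rw [Sym2.eq_iff] at h
    rcases h with ⟨h1, h2⟩ | ⟨h1, h2⟩ <;> rw [h1, h2, hx, hy] <;> decide
  · rintro ⟨hm, h⟩
    rcases ha : σ a.1
    · exact ⟨b.1, by revert h; rw [ha]; cases σ b.1 <;> simp, a.1, ha, hm, Sym2.eq_swap⟩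
    · exact ⟨a.1, ha, b.1, by revert h; rw [ha]; cases σ b.1 <;> simp, hm, rfl⟩

lemma maxBisection_inducedGraph {d : Fin n → ℕ} (m : Finset (Sym2 (HalfEdge d))) :
    maxBisection (inducedGraph m) = maxCut (halfEdgeBisections d) m := by
  classical
  have hc : ∀ (σ : Fin n → Bool) (b : Bool), {v | σ v = b}.ncard = #{v | σ v = b} := by
    intro σ b
    rw [← Set.ncard_coe_finset]
    simp
  refine IsGreatest.csSup_eq ⟨?_, ?_⟩
  · obtain ⟨τ, hτ, h⟩ := exists_cut_eq_maxCut (halfEdgeBisections_nonempty d) m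
    obtain ⟨σ, hσ, rfl⟩ := mem_image.1 hτ
    refine ⟨{v | σ v = true}, {v | σ v = false}, ⟨?_, ?_, ?_⟩, ?_⟩
    · ext v
      simp only [Set.mem_union, Set.mem_ofPred_eq, inducedGraph, Set.mem_univ, iff_true]
      cases σ v <;> simp
    · rw [Set.disjoint_left]
      intro v h1 h2
      simp only [Set.mem_ofPred_eq] at h1 h2
      simp [h1] at h2
    · rw [hc, hc]
      exact mem_bisections.1 hσ
    · rw [edgesBetween_inducedGraph, h]
  · rintro k ⟨V₁, V₂, ⟨h1, h2, h3⟩, rfl⟩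
    set σ : Fin n → Bool := fun v => decide (v ∈ V₁) with hσ
    have e1 : V₁ = {v | σ v = true} := by ext v; simp [hσ]
    have e2 : V₂ = {v | σ v = false} := by
      ext v
      have h4 : v ∈ V₁ ∪ V₂ := by rw [h1]; exact Set.mem_univ v
      have h5 : v ∈ V₁ → v ∉ V₂ := fun h => Set.disjoint_left.1 h2 h
      simp only [hσ, Set.mem_ofPred_eq, decide_eq_false_iff_not]
      rcases h4 with h | h <;> tauto
    rw [e1, e2] at h3 ⊢
    rw [hc, hc] at h3
    rw [edgesBetween_inducedGraph]
    exact cut_le_maxCut (T := halfEdgeBisections d) (τ := fun h => σ h.1)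
      (mem_image.2 ⟨σ, mem_bisections.2 h3, rfl⟩) m

end UniformMatching

/-! ### Almost sure convergence. -/

section Main

/-- First Borel–Cantelli lemma along the thresholds `1 / (k + 1)`; the tail bounds are summable. -/
lemma ae_tendsto_of_exp_bound {Ω : Type*} [MeasurableSpace Ω] {P : Measure Ω}
    [IsProbabilityMeasure P] {Y : ℕ → Ω → ℝ}
    (h : ∀ ε > 0, ∃ c > 0, ∀ᶠ n : ℕ in atTop, P.real {ω | ε ≤ |Y n ω|} ≤ 2 * Real.exp (-c * n)) :
    ∀ᵐ ω ∂P, Tendsto (fun n => Y n ω) atTop (𝓝 0) := by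
  have h1 : ∀ k : ℕ, ∀ᵐ ω ∂P, ∀ᶠ n in atTop, |Y n ω| < 1 / ((k : ℝ) + 1) := by
    intro k
    obtain ⟨c, hc, hb⟩ := h (1 / ((k : ℝ) + 1)) (by positivity)
    have hs : Summable fun n : ℕ => 2 * Real.exp (-c * n) := by
      have : Summable fun n : ℕ => Real.exp (-c) ^ n :=
        summable_geometric_of_lt_one (Real.exp_pos _).le (Real.exp_lt_one_iff.2 (by linarith))
      refine (this.mul_left 2).congr fun n => ?_
      rw [← Real.exp_nat_mul]
      ring_nf
    have hs' : Summable fun n : ℕ => P.real {ω | 1 / ((k : ℝ) + 1) ≤ |Y n ω|} := by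
      refine hs.of_norm_bounded_eventually_nat ?_
      filter_upwards [hb] with n hn
      rwa [Real.norm_of_nonneg measureReal_nonneg]
    have := hs'.tsum_ofReal_ne_top
    rw [tsum_congr fun n => ofReal_measureReal (measure_ne_top P _)] at this
    filter_upwards [ae_eventually_notMem this] with ω hω
    filter_upwards [hω] with n hn
    exact not_le.1 hn
  filter_upwards [ae_all_iff.2 h1] with ω hω
  rw [Metric.tendsto_atTop']
  intro ε hε
  obtain ⟨k, hk⟩ := exists_nat_one_div_lt hε
  obtain ⟨N, hN⟩ := eventually_atTop.1 (hω k)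
  refine ⟨N, fun n hn => ?_⟩
  rw [Real.dist_0_eq_abs]
  exact (hN n hn.le).trans hk

end Main

end ConfigurationModel

open ConfigurationModel in
theorem theorem3p1
    (μ : Measure ℕ) [IsProbabilityMeasure μ] (hμ : Integrable (fun k : ℕ => (k : ℝ)) μ)
    (d : (n : ℕ) → Fin n → ℕ) (hd : ConvergesInDistribution d μ)
    {Ω : Type*} [MeasurableSpace Ω] (P : Measure Ω) [IsProbabilityMeasure P]
    (m : (n : ℕ) → Ω → CompleteMatching (d n))
    (hlaw : ∀ n, HasLaw (m n) (uniformMatching (d n)) P)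
    (hindep : iIndepFun m P) :
    ∃ Ψ : ℝ,
      (∀ᵐ ω ∂P, Tendsto
        (fun n : ℕ => (1 / (n : ℝ)) * (maxBisection (inducedGraph (m n ω).1) : ℝ))
        atTop (𝓝 Ψ)) ∧
      Tendsto
        (fun n : ℕ => (1 / (n : ℝ)) * ∫ ω, (maxBisection (inducedGraph (m n ω).1) : ℝ) ∂P)
        atTop (𝓝 Ψ) := by
  simp only [maxBisection_inducedGraph]
  obtain ⟨Ψ, hΨ⟩ := exists_tendsto_degMaxCut hμ hd
  have hmean : ∀ n, ∫ ω, (maxCut (halfEdgeBisections (d n)) (m n ω).1 : ℝ) ∂P =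
      degMaxCut (d n) := fun n => by
    have h := (hlaw n).integral_comp (measurable_of_finite
      (fun x : CompleteMatching (d n) => (maxCut (halfEdgeBisections (d n)) x.1 : ℝ))
        ).aestronglyMeasurable
    rw [integral_uniformMatching (d n) fun m => (maxCut (halfEdgeBisections (d n)) m : ℝ)] at h
    exact h
  refine ⟨Ψ, ?_, ?_⟩
  · have key : ∀ᵐ ω ∂P, Tendsto (fun n : ℕ => (1 / (n : ℝ)) *
        ((maxCut (halfEdgeBisections (d n)) (m n ω).1 : ℝ) - degMaxCut (d n))) atTop (𝓝 0) := by
      refine ae_tendsto_of_exp_bound fun ε hε => ?_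
      set ν := ∫ k, (k : ℝ) ∂μ
      have hν0 : 0 ≤ ν := integral_nonneg fun k => Nat.cast_nonneg k
      -- The exponent `16 * t ^ 2 * (ν + 1) * n - t * ε * n` is minimal at `t = ε / (32 * (ν + 1))`,
      -- with value `-(t * ε / 2) * n`.
      refine ⟨ε / (32 * (ν + 1)) * ε / 2, by positivity, ?_⟩
      filter_upwards [hd.2.eventually (gt_mem_nhds (show ν < ν + 1 by linarith)),
        eventually_gt_atTop 0] with n hn hn0
      have hn' : (0 : ℝ) < n := by exact_mod_cast hn0
      rw [one_div, ← div_eq_inv_mul, div_lt_iff₀ hn'] at hn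
      have hset : {ω | ε ≤ |(1 / (n : ℝ)) *
          ((maxCut (halfEdgeBisections (d n)) (m n ω).1 : ℝ) - degMaxCut (d n))|} =
          {ω | ε * n ≤ |(maxCut (halfEdgeBisections (d n)) (m n ω).1 : ℝ) - degMaxCut (d n)|} := by
        ext ω
        simp only [Set.mem_ofPred_eq]
        rw [abs_mul, abs_of_pos (by positivity : (0 : ℝ) < 1 / n), one_div, ← div_eq_inv_mul,
          le_div_iff₀ hn']
      rw [hset, (hlaw n).measureReal_eq (p := fun x : CompleteMatching (d n) =>
        ε * n ≤ |(maxCut (halfEdgeBisections (d n)) x.1 : ℝ) - degMaxCut (d n)|)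
        (MeasurableSet.of_discrete)]
      refine (measureReal_abs_sub_le (d n) (t := ε / (32 * (ν + 1))) (by positivity)).trans ?_
      refine mul_le_mul_of_nonneg_left (Real.exp_le_exp.2 ?_) zero_le_two
      set t := ε / (32 * (ν + 1)) with ht
      have h1 : 16 * t ^ 2 * ((∑ i, d n i : ℕ) : ℝ) ≤ 16 * t ^ 2 * ((ν + 1) * n) := by
        refine mul_le_mul_of_nonneg_left ?_ (by positivity)
        push_cast
        exact hn.le
      have h2 : 16 * t ^ 2 * ((ν + 1) * n) = t * ε / 2 * n := by
        rw [ht]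
        field_simp
        ring
      linarith
    filter_upwards [key] with ω hω
    have := hω.add hΨ
    rw [zero_add] at this
    refine this.congr fun n => ?_
    ring
  · simp only [hmean]
    refine hΨ.congr fun n => ?_
    rw [div_eq_inv_mul, one_div]
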